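/- Let $U\subset\mathbb{R}^2$ be a nonempty bounded open set (for instance a subdomain $\Omega_j$ of a domain decomposition), let $a,c:U\to\mathbb{R}$ be measurable with $0<a_{\min}\le a\le a_{\max}$ and $0<c_{\min}\le c\le c_{\max}$ almost everywhere on $U$, let $\omega>0$ and $\kappa=\omega/c$. For complex-valued $u,v\in H^1(U)$ put $$\mathcal A(u,v)=\int_U a\,\nabla u\cdot\nabla\overline v\,dx,\qquad (\kappa^2u,v)_U=\int_U\kappa^2u\,\overline v\,dx,\qquad h(u,v)=\mathcal A(u,v)-(\kappa^2u,v)_U,$$ $$\|u\|^2=\mathcal A(u,u)+(\kappa^2u,u)_U .$$ Let $H^1_0(U)$ be the closure of $C_c^\infty(U)$ in $H^1(U)$. Let $\Lambda$ be the set of all local Dirichlet eigenvalues, i.e. of all $\lambda\in\mathbb{R}$ for which there is $0\ne b\in H^1_0(U)$ with $\mathcal A(b,v)=\lambda(\kappa^2b,v)_U$ for all $v\in H^1_0(U)$. Assume that $1\notin\Lambda$ and put $$\beta=\inf_{\lambda\in\Lambda}\frac{|\lambda-1|}{\lambda+1}.$$ Then: 1. $\beta>0$, and $$\inf_{0\ne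 u\in H^1_0(U)}\ \sup_{0\ne v\in H^1_0(U)}\frac{|h(u,v)|}{\|u\|\,\|v\|}\ge\beta,\qquad \inf_{0\ne v\in H^1_0(U)}\ \sup_{0\ne u\in H^1_0(U)}\frac{|h(u,v)|}{\|u\|\,\|v\|}\ge\beta .$$ 2. For every $t\in H^1(U)$ there is a unique $t_0\in H^1_0(U)$ with $h(t_0,v)=-h(t,v)$ for all $v\in H^1_0(U)$. 3. Let $H^{1/2}(\partial U)=H^1(U)/H^1_0(U)$ be the space of traces of functions in $H^1(U)$, with the quotient topology. There is exactly one map $E:H^{1/2}(\partial U)\to H^1(U)$ such that $E\tau=t+t_0$ for every $\tau$ and every $t\in H^1(U)$ with trace $\tau$, where $t_0$ is as in 2. This map (the local Helmholtz extension operator) is linear and continuous, and $$\|E\tau\|\le\Bigl(1+\frac1\beta\Bigr)\|t\|\qquad\text{for every }\tau\in H^{1/2}(\partial U)\text{ and every }t\in H^1(U)\text{ with trace }\tau .$$ -/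

import Mathlib

open MeasureTheory TopologicalSpace
open scoped Distributions

noncomputable section

namespace Helmholtz

/-- The plane `ℝ²` with its Euclidean structure and Lebesgue measure `volume`. -/
abbrev Plane : Type := EuclideanSpace ℝ (Fin 2)

/-- `L²(U)`: square-integrable complex-valued functions on `U` (modulo equality a.e.). -/
abbrev L2 (U : Opens Plane) : Type :=
  Lp ℂ 2 (volume.restrict (U : Set Plane))

/-- The classical partial derivative `∂ᵢ φ (x)`. -/
def partialDeriv (i : Fin 2) (φ : Plane → ℂ) (x : Plane) : ℂ :=
  fderiv ℝ φ x (EuclideanSpace.single i 1)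

/-- `g` is the weak `i`-th partial derivative of `u` in `U`. -/
def IsWeakPartial (U : Opens Plane) (i : Fin 2) (u g : L2 U) : Prop :=
  ∀ φ : 𝓓(U, ℂ),
    ∫ x in (U : Set Plane), u x * partialDeriv i φ x = -∫ x in (U : Set Plane), g x * φ x

theorem memLp_testFunction {U : Opens Plane} (φ : 𝓓(U, ℂ)) :
    MemLp φ 2 (volume.restrict (U : Set Plane)) :=
  (φ.continuous.memLp_of_hasCompactSupport φ.hasCompactSupport).restrict _

theorem memLp_partialDeriv {U : Opens Plane} (φ : 𝓓(U, ℂ)) (i : Fin 2) :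
    MemLp (partialDeriv i φ) 2 (volume.restrict (U : Set Plane)) := by
  have hc : Continuous (partialDeriv i φ) :=
    (φ.contDiff.continuous_fderiv (by simp)).clm_apply continuous_const
  have hs : HasCompactSupport (partialDeriv i φ) :=
    φ.hasCompactSupport.fderiv_apply (𝕜 := ℝ) (EuclideanSpace.single i 1)
  exact (hc.memLp_of_hasCompactSupport hs).restrict _

theorem integrable_L2_mul {U : Opens Plane} (u : L2 U) {ψ : Plane → ℂ}
    (hψ : MemLp ψ 2 (volume.restrict (U : Set Plane))) :
    Integrable (fun x => u x * ψ x) (volume.restrict (U : Set Plane)) :=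
  (Lp.memLp u).integrable_mul hψ

theorem integral_add_mul {U : Opens Plane} (u v : L2 U) {ψ : Plane → ℂ}
    (hψ : MemLp ψ 2 (volume.restrict (U : Set Plane))) :
    ∫ x in (U : Set Plane), (u + v : L2 U) x * ψ x
      = (∫ x in (U : Set Plane), u x * ψ x) + ∫ x in (U : Set Plane), v x * ψ x := by
  rw [← integral_add (integrable_L2_mul u hψ) (integrable_L2_mul v hψ)]
  refine integral_congr_ae ?_
  filter_upwards [Lp.coeFn_add u v] with x hx
  rw [hx, Pi.add_apply, add_mul]

theorem integral_smul_mul {U : Opens Plane} (k : ℂ) (u : L2 U) (ψ : Plane → ℂ) :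
    ∫ x in (U : Set Plane), (k • u : L2 U) x * ψ x
      = k * ∫ x in (U : Set Plane), u x * ψ x := by
  rw [← integral_const_mul]
  refine integral_congr_ae ?_
  filter_upwards [Lp.coeFn_smul k u] with x hx
  rw [hx, Pi.smul_apply, smul_eq_mul, mul_assoc]

theorem integral_zero_mul {U : Opens Plane} (ψ : Plane → ℂ) :
    ∫ x in (U : Set Plane), (0 : L2 U) x * ψ x = 0 := by
  simpa using integral_smul_mul (0 : ℂ) (0 : L2 U) ψ

/-- The Sobolev space `H¹(U)`: pairs of an `L²` function and its weak gradient, which is again in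
`L²`. (The weak gradient is determined by the function.) Its topology, inherited from the product
of `L²` spaces, is the one of the `H¹`-norm. -/
def sobolevH1 (U : Opens Plane) : Submodule ℂ (L2 U × (Fin 2 → L2 U)) where
  carrier := {w | ∀ i, IsWeakPartial U i w.1 (w.2 i)}
  zero_mem' := by
    intro i φ
    change ∫ x in (U : Set Plane), (0 : L2 U) x * _ = -∫ x in (U : Set Plane), (0 : L2 U) x * _
    rw [integral_zero_mul, integral_zero_mul, neg_zero]
  add_mem' := by
    intro w z hw hz i φ
    change ∫ x in (U : Set Plane), (w.1 + z.1 : L2 U) x * _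
      = -∫ x in (U : Set Plane), (w.2 i + z.2 i : L2 U) x * _
    rw [integral_add_mul _ _ (memLp_partialDeriv φ i), integral_add_mul _ _ (memLp_testFunction φ),
      hw i φ, hz i φ, neg_add]
  smul_mem' := by
    intro k w hw i φ
    change ∫ x in (U : Set Plane), (k • w.1 : L2 U) x * _
      = -∫ x in (U : Set Plane), (k • w.2 i : L2 U) x * _
    rw [integral_smul_mul, integral_smul_mul, hw i φ, mul_neg]

/-- `H¹(U)` as a type. -/
abbrev H1 (U : Opens Plane) : Type := sobolevH1 U

/-- The function underlying an element of `H¹(U)`. -/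
def H1.fn {U : Opens Plane} (u : H1 U) : L2 U := u.1.1

/-- The `i`-th weak partial derivative of an element of `H¹(U)`. -/
def H1.grad {U : Opens Plane} (u : H1 U) (i : Fin 2) : L2 U := u.1.2 i

/-- `H¹₀(U)`: the closure in `H¹(U)` of the smooth functions with compact support in `U`. -/
def H10 (U : Opens Plane) : Submodule ℂ (H1 U) :=
  (Submodule.span ℂ
    {u : H1 U | ∃ φ : 𝓓(U, ℂ), u.fn =ᵐ[volume.restrict (U : Set Plane)] φ}).topologicalClosure

/-- The form `(u, v) ↦ ∫_U a ∇u · ∇v̄ dx` on `H¹(U)`. -/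
def diffForm (U : Opens Plane) (a : Plane → ℝ) (u v : H1 U) : ℂ :=
  ∫ x in (U : Set Plane), (a x : ℂ) * ∑ i, u.grad i x * starRingEnd ℂ (v.grad i x)

/-- The weighted inner product `(κ² u, v)_U = ∫_U κ² u v̄ dx`. -/
def massForm (U : Opens Plane) (κ : Plane → ℝ) (u v : H1 U) : ℂ :=
  ∫ x in (U : Set Plane), (κ x : ℂ) ^ 2 * u.fn x * starRingEnd ℂ (v.fn x)

/-- The local Helmholtz form `∫_U a ∇u · ∇v̄ dx - (κ² u, v)_U`. -/
def helmholtzForm (U : Opens Plane) (a κ : Plane → ℝ) (u v : H1 U) : ℂ :=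
  diffForm U a u v - massForm U κ u v

/-- The energy norm: the square root of `∫_U a |∇u|² dx + (κ² u, u)_U`. -/
def energyNorm (U : Opens Plane) (a κ : Plane → ℝ) (u : H1 U) : ℝ :=
  Real.sqrt (diffForm U a u u + massForm U κ u u).re

/-- The local Dirichlet eigenvalues: real `μ` for which there is a nonzero `b ∈ H¹₀(U)` with
`∫_U a ∇b · ∇v̄ dx = μ (κ² b, v)_U` for all `v ∈ H¹₀(U)`. -/
def dirichletEigenvalues (U : Opens Plane) (a κ : Plane → ℝ) : Set ℝ :=
  {μ | ∃ b ∈ H10 U, b ≠ 0 ∧ ∀ v ∈ H10 U, diffForm U a b v = (μ : ℂ) * massForm U κ b v}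

/-- The constant `inf |μ - 1| / (μ + 1)` over all local Dirichlet eigenvalues `μ`. -/
def infSupConst (U : Opens Plane) (a κ : Plane → ℝ) : ℝ :=
  ⨅ μ : dirichletEigenvalues U a κ, |(μ : ℝ) - 1| / ((μ : ℝ) + 1)

/-- The space `H^{1/2}(∂U)` of traces of functions in `H¹(U)`. Two functions have the same trace
if and only if their difference lies in `H¹₀(U)`, so this is the quotient `H¹(U) / H¹₀(U)`. -/
abbrev TraceSpace (U : Opens Plane) : Type := H1 U ⧸ H10 U

/-- The trace of a function in `H¹(U)`. -/
def trace {U : Opens Plane} (u : H1 U) : TraceSpace U := (H10 U).mkQ u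

/-- `w ∈ H¹₀(U)` solves the local Helmholtz problem whose right-hand side is minus the residual of
`t ∈ H¹(U)`. -/
def IsCorrection (U : Opens Plane) (a κ : Plane → ℝ) (t w : H1 U) : Prop :=
  w ∈ H10 U ∧ ∀ v ∈ H10 U, helmholtzForm U a κ w v = -helmholtzForm U a κ t v

/-- `E` is the local Helmholtz extension operator: `E τ = t + t₀` for any `t ∈ H¹(U)` with
trace `τ`, where `t₀ ∈ H¹₀(U)` solves the local Helmholtz problem associated with `t`. -/
def IsHelmholtzExtension (U : Opens Plane) (a κ : Plane → ℝ) (E : TraceSpace U → H1 U) : Prop :=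
  ∀ (τ : TraceSpace U) (t : H1 U), trace t = τ →
    ∃ t₀ : H1 U, IsCorrection U a κ t t₀ ∧ E τ = t + t₀

end Helmholtz

end

/-!
In the energy inner product `𝒜(u, v) + (κ² u, v)` on `H¹(U)` the Helmholtz form on `H¹₀(U)` is
represented by the self-adjoint operator `1 - 2 L† L`, where `L u = κ u` maps to `L²(U)` and has
norm at most one. By Rellich's theorem `L` is compact, so every spectral value of `1 - 2 L† L`
other than `1` is an eigenvalue. A Dirichlet eigenvalue `μ` is an eigenvalue `1 / (μ + 1)` of
`L† L`, hence an eigenvalue `(μ - 1) / (μ + 1)` of `1 - 2 L† L`; the value `1` does not matter,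
because `|μ - 1| / (μ + 1) ≤ 1`. So the spectrum keeps the distance `β` from zero, and
self-adjointness turns this into the bound `1 / β` for the norm of the inverse. The inf-sup
conditions and the correction `t₀` follow by applying this inverse.

Rellich's theorem comes from averaging: if finitely many balls of radius `r` cover `U`, then up to
constants the `L²` norm of a test function is at most the norm of the vector of its averages over
these balls plus `r` times the norm of its gradient. Thus the embedding into `L²(U)` is dominated,
up to an arbitrarily small multiple of the `H¹` norm, by an operator of finite rank.
-/

noncomputable section

section CompactnessCriterion

universe w

variable {𝕜 X Y : Type*} [NontriviallyNormedField 𝕜] [NormedAddCommGroup X] [NormedSpace 𝕜 X]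
  [NormedAddCommGroup Y] [NormedSpace 𝕜 Y] [CompleteSpace Y]

theorem isCompactOperator_of_totallyBounded_image_ball {L : X →L[𝕜] Y}
    (h : TotallyBounded (L '' Metric.ball 0 1)) : IsCompactOperator L :=
  ⟨closure (L '' Metric.ball 0 1), h.closure.isCompact_of_isClosed isClosed_closure,
    Filter.mem_of_superset (Metric.ball_mem_nhds 0 one_pos) (Set.image_subset_iff.1 subset_closure)⟩

theorem isCompactOperator_of_forall_exists_norm_le (L : X →L[𝕜] Y)
    (h : ∀ ε > 0, ∃ (Z : Type w) (_ : NormedAddCommGroup Z) (_ : NormedSpace 𝕜 Z) (K : X →L[𝕜] Z),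
      IsCompactOperator K ∧ ∀ u, ‖L u‖ ≤ ‖K u‖ + ε * ‖u‖) : IsCompactOperator L := by
  refine isCompactOperator_of_totallyBounded_image_ball (Metric.totallyBounded_iff.2 fun δ hδ => ?_)
  obtain ⟨Z, _, _, K, hK, hLK⟩ := h (δ / 4) (by positivity)
  obtain ⟨C, hC, hKC⟩ := hK.image_subset_compact_of_bounded Metric.isBounded_ball
  obtain ⟨s, hs, hsf, hcover⟩ := Set.exists_subset_image_finite_and.1 <|
    Metric.finite_approx_of_totallyBounded (hC.totallyBounded.subset hKC) (δ / 2) (half_pos hδ)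
  refine ⟨L '' s, hsf.image L, ?_⟩
  rintro _ ⟨u, hu, rfl⟩
  obtain ⟨v, hv, hKuv⟩ : ∃ v ∈ s, dist (K u) (K v) < δ / 2 := by
    simpa using hcover (Set.mem_image_of_mem K hu)
  refine Set.mem_biUnion (Set.mem_image_of_mem L hv) ?_
  have huv : ‖u - v‖ ≤ 2 := by
    have hu1 := mem_ball_zero_iff.1 hu
    have hv1 := mem_ball_zero_iff.1 (hs hv)
    linarith [norm_sub_le u v]
  calc dist (L u) (L v) = ‖L (u - v)‖ := by rw [dist_eq_norm, map_sub]
    _ ≤ ‖K (u - v)‖ + δ / 4 * ‖u - v‖ := hLK _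
    _ < δ / 2 + δ / 4 * 2 := by
        rw [map_sub, ← dist_eq_norm]
        exact add_lt_add_of_lt_of_le hKuv (by gcongr)
    _ = δ := by ring

end CompactnessCriterion

section BallAverages

open ENNReal Metric

variable {E F : Type*} [NormedAddCommGroup E] [NormedSpace ℝ E] [NormedAddCommGroup F]
  [NormedSpace ℝ F] [CompleteSpace F]

theorem add_sq_le_two_mul_add_sq (a b : ℝ≥0∞) : (a + b) ^ 2 ≤ 2 * (a ^ 2 + b ^ 2) := by
  have h := ENNReal.rpow_add_le_mul_rpow_add_rpow a b one_le_two
  rw [show (2 : ℝ) - 1 = 1 by norm_num, rpow_one] at h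
  exact_mod_cast h

theorem sq_lintegral_le_lintegral_sq {α : Type*} [MeasurableSpace α] (ν : Measure α)
    [IsProbabilityMeasure ν] {f : α → ℝ≥0∞} (hf : AEMeasurable f ν) :
    (∫⁻ a, f a ∂ν) ^ 2 ≤ ∫⁻ a, f a ^ 2 ∂ν := by
  have h := ENNReal.lintegral_mul_le_Lp_mul_Lq ν Real.HolderConjugate.two_two hf
    (aemeasurable_const (b := 1))
  simp only [Pi.mul_apply, mul_one, one_rpow, lintegral_const, measure_univ] at h
  calc (∫⁻ a, f a ∂ν) ^ 2 ≤ ((∫⁻ a, f a ^ (2 : ℝ) ∂ν) ^ (1 / (2 : ℝ))) ^ 2 := by gcongr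
    _ = ∫⁻ a, f a ^ 2 ∂ν := by
      rw [← ENNReal.rpow_natCast, ← ENNReal.rpow_mul]; norm_num

theorem enorm_sub_sq_le_lintegral_fderiv {φ : E → F} (hφ : ContDiff ℝ 1 φ) (x h : E) :
    ‖φ (x + h) - φ x‖ₑ ^ 2
      ≤ ∫⁻ t in Set.Icc (0 : ℝ) 1, ‖h‖ₑ ^ 2 * ‖fderiv ℝ φ (x + t • h)‖ₑ ^ 2 := by
  have hline (t : ℝ) : HasDerivAt (fun t : ℝ => φ (x + t • h)) (fderiv ℝ φ (x + t • h) h) t := by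
    have : HasDerivAt (fun t : ℝ => x + t • h) h t := by
      simpa using ((hasDerivAt_id t).smul_const h).const_add x
    exact (hφ.differentiable one_ne_zero _).hasFDerivAt.comp_hasDerivAt t this
  have hcont : Continuous fun t : ℝ => fderiv ℝ φ (x + t • h) h := by
    have := hφ.continuous_fderiv one_ne_zero
    fun_prop
  have hftc : φ (x + h) - φ x = ∫ t in Set.Icc (0 : ℝ) 1, fderiv ℝ φ (x + t • h) h := by
    rw [integral_Icc_eq_integral_Ioc, ← intervalIntegral.integral_of_le zero_le_one,
      intervalIntegral.integral_eq_sub_of_hasDerivAt (fun t _ => hline t)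
        (hcont.intervalIntegrable _ _), one_smul, zero_smul, add_zero]
  have : IsProbabilityMeasure (volume.restrict (Set.Icc (0 : ℝ) 1)) := ⟨by simp⟩
  calc ‖φ (x + h) - φ x‖ₑ ^ 2
      ≤ (∫⁻ t in Set.Icc (0 : ℝ) 1, ‖fderiv ℝ φ (x + t • h) h‖ₑ) ^ 2 := by
        rw [hftc]
        gcongr
        exact enorm_integral_le_lintegral_enorm _
    _ ≤ ∫⁻ t in Set.Icc (0 : ℝ) 1, ‖fderiv ℝ φ (x + t • h) h‖ₑ ^ 2 :=
        sq_lintegral_le_lintegral_sq _ hcont.enorm.aemeasurable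
    _ ≤ _ := by
        refine lintegral_mono fun t => ?_
        rw [← mul_pow, mul_comm]
        gcongr
        exact ContinuousLinearMap.le_opENorm _ _

theorem enorm_sq_le_two_mul_enorm_average_sq_add {α : Type*} [MeasurableSpace α] (ν : Measure α)
    [IsFiniteMeasure ν] [NeZero ν] {f : α → F} (hf : Integrable f ν) (z : F) :
    ‖z‖ₑ ^ 2 ≤ 2 * ‖⨍ y, f y ∂ν‖ₑ ^ 2 + 2 * ⨍⁻ y, ‖f y - z‖ₑ ^ 2 ∂ν := by
  have hz : z = (⨍ y, f y ∂ν) - ⨍ y, f y - z ∂ν := by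
    rw [average, average, integral_sub hf.to_average (integrable_const z), integral_const,
      probReal_univ, one_smul]
    abel
  calc ‖z‖ₑ ^ 2 ≤ (‖⨍ y, f y ∂ν‖ₑ + ⨍⁻ y, ‖f y - z‖ₑ ∂ν) ^ 2 := by
        nth_rw 1 [hz]
        gcongr
        exact enorm_sub_le.trans (by gcongr; exact enorm_integral_le_lintegral_enorm _)
    _ ≤ 2 * (‖⨍ y, f y ∂ν‖ₑ ^ 2 + (⨍⁻ y, ‖f y - z‖ₑ ∂ν) ^ 2) :=
        add_sq_le_two_mul_add_sq _ _
    _ ≤ 2 * ‖⨍ y, f y ∂ν‖ₑ ^ 2 + 2 * ⨍⁻ y, ‖f y - z‖ₑ ^ 2 ∂ν := by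
        rw [mul_add]
        gcongr
        exact sq_lintegral_le_lintegral_sq _
          (hf.to_average.1.sub aestronglyMeasurable_const).enorm

theorem setLIntegral_ball_enorm_sub_sq_le {E F : Type*} [NormedAddCommGroup E] [MeasurableSpace E]
    [BorelSpace E] (μ : Measure E) [μ.IsAddLeftInvariant] [SeminormedAddCommGroup F] (φ : E → F)
    {c x : E} {r : ℝ} (hx : x ∈ ball c r) :
    ∫⁻ y in ball c r, ‖φ y - φ x‖ₑ ^ 2 ∂μ
      ≤ ∫⁻ h in ball 0 (2 * r), ‖φ (x + h) - φ x‖ₑ ^ 2 ∂μ := by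
  have hsub : ball c r ⊆ ball x (2 * r) := by
    refine ball_subset_ball' ?_
    linarith [mem_ball'.1 hx]
  have hpre : (fun h => x + h) ⁻¹' ball x (2 * r) = ball 0 (2 * r) := by
    rw [preimage_add_ball, sub_self]
  rw [← hpre, (measurePreserving_add_left μ x).setLIntegral_comp_preimage_emb
    (measurableEmbedding_addLeft x) (fun y => ‖φ y - φ x‖ₑ ^ 2)]
  exact lintegral_mono_set hsub

variable [MeasurableSpace E] [BorelSpace E] [FiniteDimensional ℝ E] (μ : Measure E)
  [μ.IsAddHaarMeasure]

theorem lintegral_enorm_translate_sub_sq_le {φ : E → F} (hφ : ContDiff ℝ 1 φ) (h : E) :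
    ∫⁻ x, ‖φ (x + h) - φ x‖ₑ ^ 2 ∂μ ≤ ‖h‖ₑ ^ 2 * ∫⁻ x, ‖fderiv ℝ φ x‖ₑ ^ 2 ∂μ := by
  calc ∫⁻ x, ‖φ (x + h) - φ x‖ₑ ^ 2 ∂μ
      ≤ ∫⁻ x, (∫⁻ t in Set.Icc (0 : ℝ) 1, ‖h‖ₑ ^ 2 * ‖fderiv ℝ φ (x + t • h)‖ₑ ^ 2) ∂μ :=
        lintegral_mono fun x => enorm_sub_sq_le_lintegral_fderiv hφ x h
    _ = ∫⁻ t in Set.Icc (0 : ℝ) 1, ∫⁻ x, ‖h‖ₑ ^ 2 * ‖fderiv ℝ φ (x + t • h)‖ₑ ^ 2 ∂μ := by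
        refine lintegral_lintegral_swap (Continuous.aemeasurable ?_)
        have hfderiv : Continuous fun p : E × ℝ => fderiv ℝ φ (p.1 + p.2 • h) :=
          (hφ.continuous_fderiv one_ne_zero).comp (by fun_prop)
        exact (ENNReal.continuous_const_mul (by simp)).comp
          ((ENNReal.continuous_pow 2).comp hfderiv.enorm)
    _ = ∫⁻ _ in Set.Icc (0 : ℝ) 1, ‖h‖ₑ ^ 2 * ∫⁻ x, ‖fderiv ℝ φ x‖ₑ ^ 2 ∂μ := by
        refine lintegral_congr fun t => ?_
        rw [lintegral_const_mul' _ _ (by simp),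
          lintegral_add_right_eq_self (fun x => ‖fderiv ℝ φ x‖ₑ ^ 2)]
    _ = ‖h‖ₑ ^ 2 * ∫⁻ x, ‖fderiv ℝ φ x‖ₑ ^ 2 ∂μ := by simp

theorem enorm_sq_le_of_mem_ball {φ : E → F} (hφ : Continuous φ) {c x : E} {r : ℝ}
    (hx : x ∈ ball c r) :
    ‖φ x‖ₑ ^ 2 ≤ 2 * ‖⨍ y in ball c r, φ y ∂μ‖ₑ ^ 2
      + 2 * ((∫⁻ h in ball 0 (2 * r), ‖φ (x + h) - φ x‖ₑ ^ 2 ∂μ) / μ (ball 0 r)) := by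
  have : NeZero (μ.restrict (ball c r)) :=
    ⟨Measure.restrict_eq_zero.not.2 (measure_ball_pos μ c (pos_of_mem_ball hx)).ne'⟩
  have : IsFiniteMeasure (μ.restrict (ball c r)) :=
    isFiniteMeasure_restrict.2 measure_ball_lt_top.ne
  have hint : IntegrableOn φ (ball c r) μ :=
    (hφ.continuousOn.integrableOn_compact (isCompact_closedBall c r)).mono_set
      ball_subset_closedBall
  refine (enorm_sq_le_two_mul_enorm_average_sq_add _ hint (φ x)).trans ?_
  rw [setLAverage_eq, ← Measure.addHaar_ball_center μ c r]
  exact add_le_add_right (mul_le_mul_right (ENNReal.div_le_div_right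
    (setLIntegral_ball_enorm_sub_sq_le μ φ hx) _) _) _

theorem lintegral_setLIntegral_ball_enorm_translate_sub_sq_le {φ : E → F} (hφ : ContDiff ℝ 1 φ)
    (r : ℝ) :
    ∫⁻ x, ∫⁻ h in ball 0 r, ‖φ (x + h) - φ x‖ₑ ^ 2 ∂μ ∂μ
      ≤ μ (ball 0 r) * (ENNReal.ofReal r ^ 2 * ∫⁻ x, ‖fderiv ℝ φ x‖ₑ ^ 2 ∂μ) := by
  have hcont : Continuous fun p : E × E => ‖φ (p.1 + p.2) - φ p.1‖ₑ ^ 2 := by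
    have := hφ.continuous
    exact (ENNReal.continuous_pow 2).comp (by fun_prop)
  rw [lintegral_lintegral_swap hcont.aemeasurable]
  calc ∫⁻ h in ball 0 r, ∫⁻ x, ‖φ (x + h) - φ x‖ₑ ^ 2 ∂μ ∂μ
      ≤ ∫⁻ _ in ball 0 r, ENNReal.ofReal r ^ 2 * ∫⁻ x, ‖fderiv ℝ φ x‖ₑ ^ 2 ∂μ ∂μ := by
        refine setLIntegral_mono' measurableSet_ball fun h hh => ?_
        refine (lintegral_enorm_translate_sub_sq_le μ hφ h).trans ?_
        gcongr
        rw [← ofReal_norm]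
        exact ofReal_le_ofReal (mem_ball_zero_iff.1 hh).le
    _ = μ (ball 0 r) * (ENNReal.ofReal r ^ 2 * ∫⁻ x, ‖fderiv ℝ φ x‖ₑ ^ 2 ∂μ) := by
        rw [setLIntegral_const, mul_comm]

theorem setLIntegral_enorm_sq_le_sum_average_add {φ : E → F} (hφ : ContDiff ℝ 1 φ) {s : Set E}
    (hs : MeasurableSet s) {r : ℝ} (hr : 0 < r) {t : Finset E} (hst : s ⊆ ⋃ c ∈ t, ball c r) :
    ∫⁻ x in s, ‖φ x‖ₑ ^ 2 ∂μ ≤ 2 * μ s * ∑ c ∈ t, ‖⨍ y in ball c r, φ y ∂μ‖ₑ ^ 2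
      + 2 ^ (Module.finrank ℝ E + 3) * ENNReal.ofReal r ^ 2 * ∫⁻ x, ‖fderiv ℝ φ x‖ₑ ^ 2 ∂μ := by
  let A := ∑ c ∈ t, ‖⨍ y in ball c r, φ y ∂μ‖ₑ ^ 2
  let G := ∫⁻ x, ‖fderiv ℝ φ x‖ₑ ^ 2 ∂μ
  let D (x : E) := ∫⁻ h in ball 0 (2 * r), ‖φ (x + h) - φ x‖ₑ ^ 2 ∂μ
  have hball : μ (ball 0 r) ≠ 0 := (measure_ball_pos μ 0 hr).ne'
  have hpt (x : E) (hx : x ∈ s) : ‖φ x‖ₑ ^ 2 ≤ 2 * A + 2 * (D x / μ (ball 0 r)) := by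
    obtain ⟨c, hc, hxc⟩ := Set.mem_iUnion₂.1 (hst hx)
    refine (enorm_sq_le_of_mem_ball μ hφ.continuous hxc).trans ?_
    gcongr
    exact Finset.single_le_sum (f := fun c => ‖⨍ y in ball c r, φ y ∂μ‖ₑ ^ 2)
      (fun _ _ => zero_le) hc
  calc ∫⁻ x in s, ‖φ x‖ₑ ^ 2 ∂μ ≤ ∫⁻ x in s, 2 * A + 2 * (D x / μ (ball 0 r)) ∂μ :=
        setLIntegral_mono' hs hpt
    _ ≤ 2 * μ s * A + ∫⁻ x, 2 * (D x / μ (ball 0 r)) ∂μ := by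
      rw [lintegral_add_left measurable_const, setLIntegral_const, mul_right_comm]
      gcongr
      exact Measure.restrict_le_self
    _ = 2 * μ s * A + 2 * ((∫⁻ x, D x ∂μ) / μ (ball 0 r)) := by
      simp only [div_eq_mul_inv]
      rw [lintegral_const_mul' _ _ ofNat_ne_top, lintegral_mul_const' _ _ (inv_ne_top.2 hball)]
    _ ≤ 2 * μ s * A + 2 * (μ (ball 0 (2 * r)) * (ENNReal.ofReal (2 * r) ^ 2 * G) / μ (ball 0 r)) :=
      by
        gcongr
        exact lintegral_setLIntegral_ball_enorm_translate_sub_sq_le μ hφ _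
    _ = 2 * μ s * A + 2 ^ (Module.finrank ℝ E + 3) * ENNReal.ofReal r ^ 2 * G := by
      rw [Measure.addHaar_ball_mul_of_pos μ 0 two_pos, ofReal_mul zero_le_two,
        ofReal_pow zero_le_two, ofReal_ofNat, mul_right_comm (2 ^ _),
        ENNReal.mul_div_cancel_right hball measure_ball_lt_top.ne]
      ring

end BallAverages

section OperatorNorm

variable {𝕜 F ι : Type*} [RCLike 𝕜] [SeminormedAddCommGroup F] [NormedSpace 𝕜 F] [Fintype ι]
  [DecidableEq ι]

theorem opNorm_sq_le_sum_norm_apply_single_sq (T : EuclideanSpace 𝕜 ι →L[𝕜] F) :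
    ‖T‖ ^ 2 ≤ ∑ i, ‖T (EuclideanSpace.single i 1)‖ ^ 2 := by
  rw [← Real.sqrt_le_sqrt_iff (by positivity), Real.sqrt_sq (norm_nonneg T)]
  refine T.opNorm_le_bound (Real.sqrt_nonneg _) fun x => ?_
  have hx : x = ∑ i, x i • EuclideanSpace.single i (1 : 𝕜) := by
    simpa using ((EuclideanSpace.basisFun ι 𝕜).sum_repr x).symm
  calc ‖T x‖ ≤ ∑ i, ‖T (EuclideanSpace.single i 1)‖ * ‖x i‖ := by
        conv_lhs => rw [hx, map_sum]
        refine (norm_sum_le _ _).trans_eq (Finset.sum_congr rfl fun i _ => ?_)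
        rw [map_smul, norm_smul, mul_comm]
    _ ≤ √(∑ i, ‖T (EuclideanSpace.single i 1)‖ ^ 2) * √(∑ i, ‖x i‖ ^ 2) :=
        Real.sum_mul_le_sqrt_mul_sqrt _ _ _
    _ = √(∑ i, ‖T (EuclideanSpace.single i 1)‖ ^ 2) * ‖x‖ := by rw [EuclideanSpace.norm_eq x]

theorem enorm_sq_le_sum_enorm_apply_single_sq (T : EuclideanSpace 𝕜 ι →L[𝕜] F) :
    ‖T‖ₑ ^ 2 ≤ ∑ i, ‖T (EuclideanSpace.single i 1)‖ₑ ^ 2 := by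
  have h : ‖T‖₊ ^ 2 ≤ ∑ i, ‖T (EuclideanSpace.single i 1)‖₊ ^ 2 := by
    rw [← NNReal.coe_le_coe]
    push_cast
    exact opNorm_sq_le_sum_norm_apply_single_sq T
  simp only [enorm_eq_nnnorm]
  exact_mod_cast h

end OperatorNorm

namespace Helmholtz

open Metric ENNReal ContDiff

variable {U : Opens Plane}

theorem setIntegral_mul_testFunction (f : Plane → ℂ) (φ : 𝓓(U, ℂ)) :
    ∫ x in (U : Set Plane), f x * φ x = ∫ x, f x * φ x := by
  refine setIntegral_eq_integral_of_forall_compl_eq_zero fun x hx => ?_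
  rw [image_eq_zero_of_notMem_tsupport fun h => hx (φ.tsupport_subset h), mul_zero]

/-- A real-valued test function, regarded as complex-valued. -/
def ofRealTestFunction {ψ : Plane → ℝ} (hψ : ContDiff ℝ ∞ ψ) (hψc : HasCompactSupport ψ)
    (hψU : tsupport ψ ⊆ U) : 𝓓(U, ℂ) where
  toFun x := (ψ x : ℂ)
  contDiff' := Complex.ofRealCLM.contDiff.comp hψ
  hasCompactSupport' := hψc.comp_left (g := Complex.ofReal) rfl
  tsupport_subset' := (tsupport_comp_subset (g := Complex.ofReal) rfl ψ).trans hψU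

theorem eq_zero_of_forall_setIntegral_mul_eq_zero (g : L2 U)
    (h : ∀ φ : 𝓓(U, ℂ), ∫ x in (U : Set Plane), g x * φ x = 0) : g = 0 := by
  have hloc : LocallyIntegrableOn g (U : Set Plane) :=
    locallyIntegrableOn_of_locallyIntegrable_restrict
      ((Lp.memLp g).locallyIntegrable one_le_two)
  rw [Lp.eq_zero_iff_ae_eq_zero]
  refine (ae_restrict_iff' U.isOpen.measurableSet).2
    (U.isOpen.ae_eq_zero_of_integral_contDiff_smul_eq_zero hloc fun ψ hψ hψc hψU => ?_)
  rw [← h (ofRealTestFunction hψ hψc hψU), setIntegral_mul_testFunction]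
  refine integral_congr_ae (.of_forall fun x => ?_)
  change (ψ x : ℝ) • g x = g x * (ψ x : ℂ)
  rw [Complex.real_smul, mul_comm]

theorem IsWeakPartial.unique {i : Fin 2} {u g g' : L2 U} (h : IsWeakPartial U i u g)
    (h' : IsWeakPartial U i u g') : g = g' := by
  refine sub_eq_zero.1 (eq_zero_of_forall_setIntegral_mul_eq_zero _ fun φ => ?_)
  rw [sub_eq_add_neg, ← neg_one_smul ℂ g', integral_add_mul _ _ (memLp_testFunction φ),
    integral_smul_mul]
  linear_combination h φ - h' φ

theorem H1.fn_injective : Function.Injective (H1.fn : H1 U → L2 U) := by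
  rintro ⟨⟨u, g⟩, hu⟩ ⟨⟨v, g'⟩, hv⟩ (rfl : u = v)
  obtain rfl : g = g' := funext fun i => (hu i).unique (hv i)
  rfl

/-- The inclusion `H¹(U) → L²(U)`. -/
def H1.fnL (U : Opens Plane) : H1 U →L[ℂ] L2 U :=
  ContinuousLinearMap.fst ℂ _ _ ∘L (sobolevH1 U).subtypeL

theorem H1.continuous_grad (i : Fin 2) : Continuous fun u : H1 U => u.grad i :=
  (continuous_apply i).comp (continuous_snd.comp continuous_subtype_val)

theorem H1.norm_grad_le (u : H1 U) (i : Fin 2) : ‖u.grad i‖ ≤ ‖u‖ :=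
  (norm_le_pi_norm u.1.2 i).trans (norm_snd_le u.1)

theorem continuous_partialDeriv (φ : 𝓓(U, ℂ)) (i : Fin 2) : Continuous (partialDeriv i φ) :=
  (φ.contDiff.continuous_fderiv (by simp)).clm_apply continuous_const

/-- A test function as an element of `L²(U)`. -/
def testLp (φ : 𝓓(U, ℂ)) : L2 U := (memLp_testFunction φ).toLp _

/-- The classical partial derivative of a test function as an element of `L²(U)`. -/
def partialDerivLp (φ : 𝓓(U, ℂ)) (i : Fin 2) : L2 U := (memLp_partialDeriv φ i).toLp _

theorem coeFn_testLp (φ : 𝓓(U, ℂ)) : testLp φ =ᵐ[volume.restrict (U : Set Plane)] φ :=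
  MemLp.coeFn_toLp _

theorem coeFn_partialDerivLp (φ : 𝓓(U, ℂ)) (i : Fin 2) :
    partialDerivLp φ i =ᵐ[volume.restrict (U : Set Plane)] partialDeriv i φ :=
  MemLp.coeFn_toLp _

theorem isWeakPartial_testLp (φ : 𝓓(U, ℂ)) (i : Fin 2) :
    IsWeakPartial U i (testLp φ) (partialDerivLp φ i) := by
  intro ψ
  have hφ : ∫ x in (U : Set Plane), testLp φ x * partialDeriv i ψ x
      = ∫ x, φ x * partialDeriv i ψ x := by
    simp_rw [mul_comm (φ _), ← setIntegral_mul_testFunction, mul_comm (partialDeriv i ψ _)]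
    exact integral_congr_ae ((coeFn_testLp φ).mono fun x hx => congrArg (· * _) hx)
  have hφ' : ∫ x in (U : Set Plane), partialDerivLp φ i x * ψ x
      = ∫ x, partialDeriv i φ x * ψ x := by
    rw [← setIntegral_mul_testFunction]
    exact integral_congr_ae ((coeFn_partialDerivLp φ i).mono fun x hx => congrArg (· * _) hx)
  have hdiff (χ : 𝓓(U, ℂ)) (x : Plane) : DifferentiableAt ℝ χ x :=
    χ.contDiff.differentiable (by simp) x
  rw [hφ, hφ']
  exact integral_mul_fderiv_eq_neg_fderiv_mul_of_integrable (μ := (volume : Measure Plane))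
    (f := φ) (g := ψ) (v := EuclideanSpace.single i 1)
    (((continuous_partialDeriv φ i).mul ψ.continuous).integrable_of_hasCompactSupport
      ψ.hasCompactSupport.mul_left)
    ((φ.continuous.mul (continuous_partialDeriv ψ i)).integrable_of_hasCompactSupport
      φ.hasCompactSupport.mul_right)
    ((φ.continuous.mul ψ.continuous).integrable_of_hasCompactSupport φ.hasCompactSupport.mul_right)
    (fun x _ => hdiff φ x) (fun x _ => hdiff ψ x)

/-- A test function as an element of `H¹(U)`. -/
def testH1 (φ : 𝓓(U, ℂ)) : H1 U := ⟨(testLp φ, partialDerivLp φ), isWeakPartial_testLp φ⟩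

theorem testH1_mem_H10 (φ : 𝓓(U, ℂ)) : testH1 φ ∈ H10 U :=
  Submodule.le_topologicalClosure _ (Submodule.subset_span ⟨φ, coeFn_testLp φ⟩)

theorem eq_testH1_of_fn_ae_eq {u : H1 U} {φ : 𝓓(U, ℂ)}
    (h : u.fn =ᵐ[volume.restrict (U : Set Plane)] φ) : u = testH1 φ :=
  H1.fn_injective (Lp.ext (h.trans (coeFn_testLp φ).symm))

theorem H10_induction {P : H1 U → Prop} (hP : IsClosed {u | P u})
    (h : ∀ φ : 𝓓(U, ℂ), P (testH1 φ)) {u : H1 U} (hu : u ∈ H10 U) : P u := by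
  refine closure_minimal (t := {u | P u}) (fun v hv => ?_) hP hu
  suffices ∃ φ : 𝓓(U, ℂ), v.fn =ᵐ[volume.restrict (U : Set Plane)] φ by
    obtain ⟨φ, hφ⟩ := this
    exact eq_testH1_of_fn_ae_eq hφ ▸ h φ
  induction hv using Submodule.span_induction with
  | mem _ hv => exact hv
  | zero => exact ⟨0, Lp.coeFn_zero _ _ _⟩
  | add v w _ _ hv hw =>
    obtain ⟨φ, hφ⟩ := hv
    obtain ⟨ψ, hψ⟩ := hw
    exact ⟨φ + ψ, (Lp.coeFn_add v.fn w.fn).trans (hφ.add hψ)⟩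
  | smul c v _ hv =>
    obtain ⟨φ, hφ⟩ := hv
    exact ⟨c • φ, (Lp.coeFn_smul c v.fn).trans (hφ.const_smul c)⟩

theorem nontrivial_H10 (hU : (U : Set Plane).Nonempty) : Nontrivial (H10 U) := by
  obtain ⟨x, hx⟩ := hU
  obtain ⟨ψ, hψU, hψc, hψ, -, hψx⟩ :=
    exists_contDiff_tsupport_subset (n := ⊤) (U.isOpen.mem_nhds hx)
  let φ : 𝓓(U, ℂ) := ofRealTestFunction hψ hψc hψU
  refine ⟨⟨testH1 φ, testH1_mem_H10 φ⟩, 0, fun h => ?_⟩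
  have hLp : testLp φ = 0 := congrArg (fun u : H10 U => u.1.fn) h
  have hae : (φ : Plane → ℂ) =ᵐ[volume.restrict (U : Set Plane)] 0 :=
    (coeFn_testLp φ).symm.trans (hLp ▸ Lp.coeFn_zero _ _ _)
  have hφx : (ψ x : ℂ) = 0 :=
    Measure.eqOn_open_of_ae_eq hae U.isOpen φ.continuous.continuousOn continuousOn_const hx
  exact one_ne_zero (hψx.symm.trans (Complex.ofReal_eq_zero.1 hφx))

theorem enorm_sq_eq_setLIntegral_of_ae_eq {f : L2 U} {g : Plane → ℂ}
    (hfg : f =ᵐ[volume.restrict (U : Set Plane)] g) :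
    ‖f‖ₑ ^ 2 = ∫⁻ x in (U : Set Plane), ‖g x‖ₑ ^ 2 := by
  have h := eLpNorm_nnreal_pow_eq_lintegral (p := 2) (f := f)
    (μ := volume.restrict (U : Set Plane)) two_ne_zero
  rw [Lp.enorm_def, ← lintegral_congr_ae (hfg.mono fun x hx => congrArg (‖·‖ₑ ^ 2) hx)]
  simpa using h

theorem lintegral_enorm_fderiv_sq_le (φ : 𝓓(U, ℂ)) :
    ∫⁻ x, ‖fderiv ℝ φ x‖ₑ ^ 2 ≤ ∑ i, ‖partialDerivLp φ i‖ₑ ^ 2 := by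
  have hsupp : Function.support (fun x => ‖fderiv ℝ φ x‖ₑ ^ 2) ⊆ U := fun x hx => by
    refine φ.tsupport_subset (tsupport_fderiv_subset ℝ (subset_tsupport _ fun h => hx ?_))
    simp [h, enorm_eq_nnnorm]
  calc ∫⁻ x, ‖fderiv ℝ φ x‖ₑ ^ 2
      = ∫⁻ x in (U : Set Plane), ‖fderiv ℝ φ x‖ₑ ^ 2 :=
        (setLIntegral_eq_of_support_subset hsupp).symm
    _ ≤ ∫⁻ x in (U : Set Plane), ∑ i, ‖partialDeriv i φ x‖ₑ ^ 2 :=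
        lintegral_mono fun x => enorm_sq_le_sum_enorm_apply_single_sq _
    _ = ∑ i, ‖partialDerivLp φ i‖ₑ ^ 2 := by
        rw [lintegral_finsetSum _ fun i _ =>
          (continuous_partialDeriv φ i).enorm.measurable.pow_const 2]
        simp_rw [enorm_sq_eq_setLIntegral_of_ae_eq (coeFn_partialDerivLp φ _)]

/-- The average over the ball `B(c, r)` of a function in `L²(U)` extended by zero, as a continuous
linear functional. -/
def ballAverage (U : Opens Plane) (c : Plane) (r : ℝ) : L2 U →L[ℂ] ℂ :=
  ((volume.real (ball c r))⁻¹ : ℂ) • innerSL ℂ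
    (indicatorConstLp 2 (measurableSet_ball (x := c) (ε := r))
      ((Measure.restrict_apply_le _ _).trans_lt measure_ball_lt_top).ne (1 : ℂ))

theorem ballAverage_testLp (c : Plane) (r : ℝ) (φ : 𝓓(U, ℂ)) :
    ballAverage U c r (testLp φ) = ⨍ y in ball c r, φ y := by
  rw [ballAverage, _root_.smul_apply, innerSL_apply_apply,
    L2.inner_indicatorConstLp_one, setAverage_eq, ← Complex.ofReal_inv, Complex.coe_smul,
    integral_congr_ae (ae_restrict_of_ae (coeFn_testLp φ)),
    Measure.restrict_comm measurableSet_ball]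
  congr 1
  exact setIntegral_eq_integral_of_forall_compl_eq_zero fun x hx =>
    image_eq_zero_of_notMem_tsupport fun h => hx (φ.tsupport_subset h)

theorem enorm_testLp_sq_le_sum_ballAverage_add {r : ℝ} (hr : 0 < r) {t : Finset Plane}
    (ht : (U : Set Plane) ⊆ ⋃ c ∈ t, ball c r) (φ : 𝓓(U, ℂ)) :
    ‖testLp φ‖ₑ ^ 2 ≤ 2 * volume (U : Set Plane) * ∑ c ∈ t, ‖ballAverage U c r (testLp φ)‖ₑ ^ 2
      + 32 * ENNReal.ofReal r ^ 2 * ∑ i, ‖partialDerivLp φ i‖ₑ ^ 2 := by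
  simp_rw [ballAverage_testLp, enorm_sq_eq_setLIntegral_of_ae_eq (coeFn_testLp φ)]
  refine (setLIntegral_enorm_sq_le_sum_average_add volume (φ.contDiff.of_le (by simp))
    U.isOpen.measurableSet hr ht).trans ?_
  rw [finrank_euclideanSpace_fin]
  norm_num1
  gcongr
  exact lintegral_enorm_fderiv_sq_le φ

theorem norm_fn_sq_le_sum_ballAverage_add (hU : Bornology.IsBounded (U : Set Plane)) {r : ℝ}
    (hr : 0 < r) {t : Finset Plane} (ht : (U : Set Plane) ⊆ ⋃ c ∈ t, ball c r) {u : H1 U}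
    (hu : u ∈ H10 U) :
    ‖u.fn‖ ^ 2 ≤ 2 * volume.real (U : Set Plane) * ∑ c ∈ t, ‖ballAverage U c r u.fn‖ ^ 2
      + 32 * r ^ 2 * ∑ i, ‖u.grad i‖ ^ 2 := by
  have hfn : Continuous fun u : H1 U => u.fn := (H1.fnL U).continuous
  have hgrad (i : Fin 2) := H1.continuous_grad (U := U) i
  refine H10_induction (P := fun u => ‖u.fn‖ ^ 2 ≤ 2 * volume.real (U : Set Plane)
    * ∑ c ∈ t, ‖ballAverage U c r u.fn‖ ^ 2 + 32 * r ^ 2 * ∑ i, ‖u.grad i‖ ^ 2)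
    (isClosed_le (by fun_prop) (by fun_prop)) (fun φ => ?_) hu
  have h := enorm_testLp_sq_le_sum_ballAverage_add hr ht φ
  rw [← ENNReal.coe_toNNReal hU.measure_lt_top.ne, ENNReal.ofReal] at h
  simp only [enorm_eq_nnnorm] at h
  have h' : ‖testLp φ‖₊ ^ 2 ≤ 2 * (volume (U : Set Plane)).toNNReal
      * ∑ c ∈ t, ‖ballAverage U c r (testLp φ)‖₊ ^ 2
      + 32 * r.toNNReal ^ 2 * ∑ i, ‖partialDerivLp φ i‖₊ ^ 2 := by
    exact_mod_cast h
  rw [← NNReal.coe_le_coe] at h'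
  push_cast at h'
  rwa [Real.coe_toNNReal r hr.le] at h'

/-- The inclusion `H¹₀(U) → L²(U)`. -/
def H10.fnL (U : Opens Plane) : H10 U →L[ℂ] L2 U := H1.fnL U ∘L (H10 U).subtypeL

theorem H10.isCompactOperator_fnL (hU : Bornology.IsBounded (U : Set Plane)) :
    IsCompactOperator (H10.fnL U) := by
  refine isCompactOperator_of_forall_exists_norm_le.{0} (𝕜 := ℂ) (X := H10 U) (H10.fnL U)
    fun ε hε => ?_
  obtain ⟨s, hs, hcover⟩ := totallyBounded_iff.1
    (hU.isCompact_closure.totallyBounded.subset subset_closure) (ε / 8) (by positivity)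
  lift s to Finset Plane using hs
  let averages : L2 U →L[ℂ] EuclideanSpace ℂ s := (√(2 * volume.real (U : Set Plane)) : ℂ) •
    (PiLp.continuousLinearEquiv 2 ℂ fun _ : s => ℂ).symm.toContinuousLinearMap ∘L
      ContinuousLinearMap.pi fun c : s => ballAverage U c (ε / 8)
  let K : H10 U →L[ℂ] EuclideanSpace ℂ s := averages ∘L H10.fnL U
  refine ⟨EuclideanSpace ℂ s, inferInstance, inferInstance, K,
    (isCompactOperator_of_locallyCompactSpace_dom averages).comp_clm (H10.fnL U), fun u => ?_⟩
  have hK : ‖K u‖ ^ 2 = 2 * volume.real (U : Set Plane)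
      * ∑ c ∈ s, ‖ballAverage U c (ε / 8) u.1.fn‖ ^ 2 := by
    rw [← Finset.sum_coe_sort s, ContinuousLinearMap.comp_apply, _root_.smul_apply, norm_smul,
      mul_pow, EuclideanSpace.norm_sq_eq, Complex.norm_real,
      Real.norm_of_nonneg (Real.sqrt_nonneg _), Real.sq_sqrt (by positivity)]
    rfl
  have hgrad : ∑ i, ‖u.1.grad i‖ ^ 2 ≤ 2 * ‖u‖ ^ 2 := by
    simpa using Finset.sum_le_card_nsmul Finset.univ (fun i => ‖u.1.grad i‖ ^ 2) (‖u‖ ^ 2)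
      fun i _ => pow_le_pow_left₀ (norm_nonneg _) (u.1.norm_grad_le i) 2
  refine abs_le_of_sq_le_sq' ?_ (by positivity) |>.2
  calc ‖u.1.fn‖ ^ 2 ≤ ‖K u‖ ^ 2 + 32 * (ε / 8) ^ 2 * (2 * ‖u‖ ^ 2) := by
        rw [hK]
        exact (norm_fn_sq_le_sum_ballAverage_add hU (by positivity) hcover u.2).trans (by gcongr)
    _ ≤ (‖K u‖ + ε * ‖u‖) ^ 2 := by
        nlinarith [mul_nonneg (norm_nonneg (K u)) (mul_nonneg hε.le (norm_nonneg u))]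

end Helmholtz

theorem inv_mem_spectrum_units_inv {𝕜 A : Type*} [Field 𝕜] [Ring A] [Algebra 𝕜 A] {S : Aˣ} {s : 𝕜}
    (hs : s ∈ spectrum 𝕜 (S : A)) : s⁻¹ ∈ spectrum 𝕜 (↑S⁻¹ : A) := by
  rwa [← spectrum.map_inv, Set.inv_mem_inv]

theorem inv_norm_units_inv_le_norm_of_mem_spectrum {𝕜 A : Type*} [NormedField 𝕜] [NormedRing A]
    [NormedAlgebra 𝕜 A] [CompleteSpace A] [NormOneClass A] {S : Aˣ} {s : 𝕜}
    (hs : s ∈ spectrum 𝕜 (S : A)) : ‖(↑S⁻¹ : A)‖⁻¹ ≤ ‖s‖ := by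
  have hs0 : s ≠ 0 := spectrum.ne_zero_of_mem_of_unit hs
  have h := spectrum.norm_le_norm_of_mem (inv_mem_spectrum_units_inv hs)
  rw [norm_inv] at h
  exact inv_le_of_inv_le₀ (norm_pos_iff.2 hs0) h

theorem norm_units_inv_le_of_forall_mem_spectrum_le {A : Type*} [CStarAlgebra A] {S : Aˣ}
    (hS : IsSelfAdjoint (S : A)) {β : ℝ} (hβ : 0 < β) (h : ∀ s ∈ spectrum ℂ (S : A), β ≤ ‖s‖) :
    ‖(↑S⁻¹ : A)‖ ≤ β⁻¹ := by
  have hS' : IsSelfAdjoint (↑S⁻¹ : A) := Ring.inverse_unit S ▸ hS.ringInverse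
  suffices spectralRadius ℂ (↑S⁻¹ : A) ≤ ENNReal.ofReal β⁻¹ by
    rwa [hS'.spectralRadius_eq_nnnorm, ← enorm_eq_nnnorm, ← ofReal_norm,
      ENNReal.ofReal_le_ofReal_iff (by positivity)] at this
  refine iSup₂_le fun s hs => ?_
  rw [← enorm_eq_nnnorm, ← ofReal_norm]
  refine ENNReal.ofReal_le_ofReal ((le_inv_comm₀ hβ ?_).1 ?_)
  · exact norm_pos_iff.2 (spectrum.ne_zero_of_mem_of_unit hs)
  · rw [← norm_inv]
    exact h _ (inv_inv S ▸ inv_mem_spectrum_units_inv hs)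

section RelativeEigenvalues

open ContinuousLinearMap Module.End

variable {V F : Type*} [NormedAddCommGroup V] [InnerProductSpace ℂ V]
  [NormedAddCommGroup F] [InnerProductSpace ℂ F] {L : V →L[ℂ] F} {μ : ℝ}

/-- The real eigenvalues `μ` of the form `⟪v, b⟫ - ⟪L v, L b⟫` relative to the form
`⟪L v, L b⟫`. -/
def relativeEigenvalues (L : V →L[ℂ] F) : Set ℝ :=
  {μ | ∃ b : V, b ≠ 0 ∧ ∀ v, inner ℂ v b - inner ℂ (L v) (L b) = (μ : ℂ) * inner ℂ (L v) (L b)}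

/-- The infimum of the moduli `|μ - 1| / (μ + 1)` of the eigenvalues of `1 - 2 L† L`, expressed
through the relative eigenvalues `μ` of `L`. -/
def spectralGap (L : V →L[ℂ] F) : ℝ :=
  ⨅ μ : relativeEigenvalues L, |(μ : ℝ) - 1| / ((μ : ℝ) + 1)

theorem nonneg_of_mem_relativeEigenvalues (hL : ‖L‖ ≤ 1) (hμ : μ ∈ relativeEigenvalues L) :
    0 ≤ μ := by
  obtain ⟨b, hb, h⟩ := hμ
  have hb' : ‖b‖ ^ 2 = (μ + 1) * ‖L b‖ ^ 2 := by
    have hbb := h b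
    rw [inner_self_eq_norm_sq_to_K, inner_self_eq_norm_sq_to_K] at hbb
    have : (‖b‖ ^ 2 : ℂ) = (μ + 1) * ‖L b‖ ^ 2 := by linear_combination hbb
    exact_mod_cast this
  have hLb : ‖L b‖ ^ 2 ≤ ‖b‖ ^ 2 :=
    pow_le_pow_left₀ (norm_nonneg _) (by simpa using L.le_of_opNorm_le hL b) 2
  have hb0 : 0 < ‖b‖ ^ 2 := pow_pos (norm_pos_iff.2 hb) 2
  have hLb0 : 0 < ‖L b‖ ^ 2 := (sq_nonneg _).lt_of_ne' fun h0 => by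
    rw [h0, mul_zero] at hb'
    exact hb0.ne' hb'
  by_contra! hμ
  nlinarith

theorem spectralGap_le (hL : ‖L‖ ≤ 1) (hμ : μ ∈ relativeEigenvalues L) :
    spectralGap L ≤ |μ - 1| / (μ + 1) :=
  ciInf_le (f := fun μ : relativeEigenvalues L => |(μ : ℝ) - 1| / ((μ : ℝ) + 1))
    ⟨0, Set.forall_mem_range.2 fun μ =>
      have := nonneg_of_mem_relativeEigenvalues hL μ.2
      by positivity⟩ ⟨μ, hμ⟩

theorem spectralGap_le_one (hL : ‖L‖ ≤ 1) (h : (relativeEigenvalues L).Nonempty) :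
    spectralGap L ≤ 1 := by
  obtain ⟨μ, hμ⟩ := h
  have hμ0 := nonneg_of_mem_relativeEigenvalues hL hμ
  refine (spectralGap_le hL hμ).trans ((div_le_one (by positivity)).2 ?_)
  exact abs_le.2 ⟨by linarith, by linarith⟩

variable [CompleteSpace V] [CompleteSpace F]

theorem mem_relativeEigenvalues_iff (hμ : μ + 1 ≠ 0) :
    μ ∈ relativeEigenvalues L ↔
      HasEigenvalue ((adjoint L ∘L L : V →L[ℂ] V) : Module.End ℂ V) ((μ : ℂ) + 1)⁻¹ := by
  have hμ' : (μ : ℂ) + 1 ≠ 0 := by exact_mod_cast hμ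
  have hiff (b : V) : (∀ v, inner ℂ v b - inner ℂ (L v) (L b) = (μ : ℂ) * inner ℂ (L v) (L b)) ↔
      (adjoint L ∘L L) b = ((μ : ℂ) + 1)⁻¹ • b := by
    rw [eq_inv_smul_iff₀ hμ', ext_iff_inner_left ℂ]
    refine forall_congr' fun v => ?_
    rw [inner_smul_right, ContinuousLinearMap.comp_apply, adjoint_inner_right]
    constructor <;> intro h <;> linear_combination -h
  constructor
  · rintro ⟨b, hb, h⟩
    exact hasEigenvalue_of_hasEigenvector ⟨mem_eigenspace_iff.2 ((hiff b).1 h), hb⟩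
  · intro h
    obtain ⟨b, hb⟩ := h.exists_hasEigenvector
    exact ⟨b, hb.2, (hiff b).2 hb.apply_eq_smul⟩

theorem exists_pos_eq_of_hasEigenvalue_adjoint_comp_self (hL : Function.Injective L) {θ : ℂ}
    (hθ : HasEigenvalue ((adjoint L ∘L L : V →L[ℂ] V) : Module.End ℂ V) θ) :
    ∃ t : ℝ, 0 < t ∧ (t : ℂ) = θ := by
  obtain ⟨b, hb⟩ := hθ.exists_hasEigenvector
  have hLb : L b ≠ 0 := (map_ne_zero_iff L hL).2 hb.2
  have hb' : (‖L b‖ ^ 2 : ℂ) = θ * ‖b‖ ^ 2 := by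
    have h : adjoint L (L b) = θ • b := hb.apply_eq_smul
    have := congrArg (inner ℂ b) h
    rwa [adjoint_inner_right, inner_smul_right, inner_self_eq_norm_sq_to_K,
      inner_self_eq_norm_sq_to_K] at this
  have hb0 : ‖b‖ ≠ 0 := norm_ne_zero_iff.2 hb.2
  refine ⟨‖L b‖ ^ 2 / ‖b‖ ^ 2, by positivity, ?_⟩
  push_cast
  rw [hb', mul_div_cancel_right₀]
  exact_mod_cast pow_ne_zero 2 hb0

theorem exists_mem_relativeEigenvalues_of_hasEigenvalue (hL : Function.Injective L) {θ : ℂ}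
    (hθ : HasEigenvalue ((adjoint L ∘L L : V →L[ℂ] V) : Module.End ℂ V) θ) :
    ∃ μ ∈ relativeEigenvalues L, θ = ((μ : ℂ) + 1)⁻¹ := by
  obtain ⟨t, ht, rfl⟩ := exists_pos_eq_of_hasEigenvalue_adjoint_comp_self hL hθ
  have hinv : (t : ℂ) = (((t⁻¹ - 1 : ℝ) : ℂ) + 1)⁻¹ := by simp
  refine ⟨t⁻¹ - 1, (mem_relativeEigenvalues_iff (by simpa using ht.ne')).2 (hinv ▸ hθ), hinv⟩

theorem isSelfAdjoint_adjoint_comp_self (L : V →L[ℂ] F) : IsSelfAdjoint (adjoint L ∘L L) := by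
  rw [isSelfAdjoint_iff', adjoint_comp, adjoint_adjoint]

theorem nonempty_relativeEigenvalues [Nontrivial V] (hLc : IsCompactOperator L)
    (hL : Function.Injective L) : (relativeEigenvalues L).Nonempty := by
  by_contra! hempty
  have hzero : adjoint L ∘L L = 0 := by
    refine (eq_zero_of_forall_hasEigenvalue_eq_zero (hLc.clm_comp (adjoint L)) ?_).1 fun θ hθ => ?_
    · exact (isSelfAdjoint_adjoint_comp_self L).isSymmetric
    · obtain ⟨μ, hμ, -⟩ := exists_mem_relativeEigenvalues_of_hasEigenvalue hL hθ
      simp [hempty] at hμ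
  obtain ⟨b, hb⟩ := exists_ne (0 : V)
  refine (map_ne_zero_iff L hL).2 hb (inner_self_eq_zero (𝕜 := ℂ).1 ?_)
  rw [← adjoint_inner_right, ← ContinuousLinearMap.comp_apply, hzero]
  simp

end RelativeEigenvalues

section HelmholtzOp

open ContinuousLinearMap Module.End

variable {V F : Type*} [NormedAddCommGroup V] [InnerProductSpace ℂ V] [CompleteSpace V]
  [NormedAddCommGroup F] [InnerProductSpace ℂ F] [CompleteSpace F] {L : V →L[ℂ] F}

/-- The operator `1 - 2 L† L`. It represents the Helmholtz form when the inner product of `V` is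
the energy inner product and `‖L u‖²` is the mass term. -/
def helmholtzOp (L : V →L[ℂ] F) : V →L[ℂ] V := 1 - (2 : ℂ) • (adjoint L ∘L L)

theorem inner_helmholtzOp (L : V →L[ℂ] F) (v u : V) :
    inner ℂ v (helmholtzOp L u) = inner ℂ v u - 2 * inner ℂ (L v) (L u) := by
  change inner ℂ v (u - (2 : ℂ) • adjoint L (L u)) = _
  rw [inner_sub_right, inner_smul_right, adjoint_inner_right]

theorem isSelfAdjoint_helmholtzOp (L : V →L[ℂ] F) : IsSelfAdjoint (helmholtzOp L) :=
  (IsSelfAdjoint.one _).sub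
    ((by simp : IsSelfAdjoint (2 : ℂ)).smul (isSelfAdjoint_adjoint_comp_self L))

theorem norm_helmholtzOp_apply_le (hL : ‖L‖ ≤ 1) (u : V) : ‖helmholtzOp L u‖ ≤ ‖u‖ := by
  have hT : ‖adjoint L (L u)‖ ≤ ‖L u‖ := by
    simpa using (adjoint L).le_of_opNorm_le ((LinearIsometryEquiv.norm_map _ L).trans_le hL) (L u)
  refine le_of_sq_le_sq ?_ (norm_nonneg u)
  change ‖u - (2 : ℂ) • adjoint L (L u)‖ ^ 2 ≤ _
  rw [norm_sub_sq (𝕜 := ℂ), inner_smul_right, adjoint_inner_right, norm_smul]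
  have hre : RCLike.re ((2 : ℂ) * inner ℂ (L u) (L u)) = 2 * ‖L u‖ ^ 2 := by
    rw [two_mul, map_add, inner_self_eq_norm_sq, two_mul]
  have hsq : ‖adjoint L (L u)‖ ^ 2 ≤ ‖L u‖ ^ 2 := pow_le_pow_left₀ (norm_nonneg _) hT 2
  rw [Complex.norm_ofNat, hre]
  linarith

theorem mem_spectrum_helmholtzOp_iff {s : ℂ} :
    s ∈ spectrum ℂ (helmholtzOp L) ↔ (1 - s) / 2 ∈ spectrum ℂ (adjoint L ∘L L) := by
  have h : algebraMap ℂ (V →L[ℂ] V) s - helmholtzOp L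
      = Units.mk0 (-2 : ℂ) (by norm_num) • (algebraMap ℂ _ ((1 - s) / 2) - adjoint L ∘L L) := by
    rw [Units.smul_mk0, smul_sub, Algebra.algebraMap_eq_smul_one, Algebra.algebraMap_eq_smul_one,
      helmholtzOp]
    module
  rw [spectrum.mem_iff, spectrum.mem_iff, h, isUnit_smul_iff]

theorem mem_spectrum_helmholtzOp_of_mem_relativeEigenvalues (hL : ‖L‖ ≤ 1) {μ : ℝ}
    (hμ : μ ∈ relativeEigenvalues L) :
    (((μ - 1) / (μ + 1) : ℝ) : ℂ) ∈ spectrum ℂ (helmholtzOp L) := by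
  have hμ0 : μ + 1 ≠ 0 := by linarith [nonneg_of_mem_relativeEigenvalues hL hμ]
  have hθ : ((μ : ℂ) + 1)⁻¹ ∈ spectrum ℂ (adjoint L ∘L L) := by
    rw [ContinuousLinearMap.spectrum_eq]
    exact ((mem_relativeEigenvalues_iff hμ0).1 hμ).mem_spectrum
  have hμ0' : (μ : ℂ) + 1 ≠ 0 := by exact_mod_cast hμ0
  convert mem_spectrum_helmholtzOp_iff.2 (?_ : (1 - ((μ : ℂ) - 1) / (μ + 1)) / 2 ∈ _) using 1
  · push_cast
    rfl
  · convert hθ using 1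
    field_simp
    ring

theorem spectralGap_le_norm_of_mem_spectrum [Nontrivial V] (hLc : IsCompactOperator L)
    (hLi : Function.Injective L) (hL : ‖L‖ ≤ 1) {s : ℂ} (hs : s ∈ spectrum ℂ (helmholtzOp L)) :
    spectralGap L ≤ ‖s‖ := by
  rcases eq_or_ne s 1 with rfl | hs1
  · rw [norm_one]
    exact spectralGap_le_one hL (nonempty_relativeEigenvalues hLc hLi)
  have hθ : (1 - s) / 2 ≠ 0 := div_ne_zero (sub_ne_zero.2 hs1.symm) two_ne_zero
  rw [mem_spectrum_helmholtzOp_iff,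
    ← (hLc.clm_comp (adjoint L)).hasEigenvalue_iff_mem_spectrum hθ] at hs
  obtain ⟨μ, hμ, hμs⟩ := exists_mem_relativeEigenvalues_of_hasEigenvalue hLi hs
  have hμ0 := nonneg_of_mem_relativeEigenvalues hL hμ
  have hμ0' : (μ : ℂ) + 1 ≠ 0 := by exact_mod_cast (by positivity : μ + 1 ≠ 0)
  have hs_eq : s = ((μ - 1) / (μ + 1) : ℝ) := by
    push_cast
    rw [div_eq_iff two_ne_zero] at hμs
    rw [eq_div_iff hμ0']
    linear_combination -(μ + 1) * hμs - 2 * inv_mul_cancel₀ hμ0'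
  rw [hs_eq, Complex.norm_real, Real.norm_eq_abs, abs_div,
    abs_of_nonneg (by positivity : 0 ≤ μ + 1)]
  exact spectralGap_le hL hμ

theorem isUnit_helmholtzOp (hLc : IsCompactOperator L) (h1 : (1 : ℝ) ∉ relativeEigenvalues L) :
    IsUnit (helmholtzOp L) := by
  rw [← spectrum.zero_notMem_iff ℂ, mem_spectrum_helmholtzOp_iff,
    ← (hLc.clm_comp (adjoint L)).hasEigenvalue_iff_mem_spectrum (by norm_num)]
  rw [mem_relativeEigenvalues_iff (by norm_num)] at h1
  have hhalf : ((1 : ℂ) - 0) / 2 = (((1 : ℝ) : ℂ) + 1)⁻¹ := by norm_num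
  rwa [hhalf]

theorem spectralGap_pos [Nontrivial V] (hLc : IsCompactOperator L) (hLi : Function.Injective L)
    (hL : ‖L‖ ≤ 1) (h1 : (1 : ℝ) ∉ relativeEigenvalues L) : 0 < spectralGap L := by
  obtain ⟨S, hS⟩ := isUnit_helmholtzOp hLc h1
  have := (nonempty_relativeEigenvalues hLc hLi).to_subtype
  refine (inv_pos.2 (Units.norm_pos S⁻¹)).trans_le (le_ciInf fun μ => ?_)
  have hμ0 := nonneg_of_mem_relativeEigenvalues hL μ.2
  have hμ := mem_spectrum_helmholtzOp_of_mem_relativeEigenvalues hL μ.2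
  have h := inv_norm_units_inv_le_norm_of_mem_spectrum (hS ▸ hμ)
  rwa [Complex.norm_real, Real.norm_eq_abs, abs_div,
    abs_of_nonneg (by positivity : 0 ≤ (μ : ℝ) + 1)] at h

theorem spectralGap_mul_norm_le [Nontrivial V] (hLc : IsCompactOperator L)
    (hLi : Function.Injective L) (hL : ‖L‖ ≤ 1) (h1 : (1 : ℝ) ∉ relativeEigenvalues L) (u : V) :
    spectralGap L * ‖u‖ ≤ ‖helmholtzOp L u‖ := by
  obtain ⟨S, hS⟩ := isUnit_helmholtzOp hLc h1
  have hgap := spectralGap_pos hLc hLi hL h1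
  have hinv : ‖(↑S⁻¹ : V →L[ℂ] V)‖ ≤ (spectralGap L)⁻¹ :=
    norm_units_inv_le_of_forall_mem_spectrum_le (hS ▸ isSelfAdjoint_helmholtzOp L) hgap
      fun s hs => spectralGap_le_norm_of_mem_spectrum hLc hLi hL (hS ▸ hs)
  rw [← hS, ← le_inv_mul_iff₀ hgap]
  calc ‖u‖ = ‖(↑S⁻¹ : V →L[ℂ] V) ((S : V →L[ℂ] V) u)‖ := by
        rw [← mul_apply_eq_comp, S.inv_mul, one_apply_eq_self]
    _ ≤ (spectralGap L)⁻¹ * ‖(S : V →L[ℂ] V) u‖ := ContinuousLinearMap.le_of_opNorm_le _ hinv _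

end HelmholtzOp

section GalerkinCorrection

open ContinuousLinearMap

variable {H F : Type*} [NormedAddCommGroup H] [InnerProductSpace ℂ H]
  [NormedAddCommGroup F] [InnerProductSpace ℂ F] {V : Submodule ℂ H} {M : H →L[ℂ] F}

theorem norm_comp_subtypeL_le_one (hM : ‖M‖ ≤ 1) : ‖M ∘L V.subtypeL‖ ≤ 1 :=
  (opNorm_comp_le _ _).trans (mul_le_one₀ hM (norm_nonneg _) V.norm_subtypeL_le)

variable [CompleteSpace H] [CompleteSpace F] [CompleteSpace V]

theorem helmholtzOp_comp_subtypeL (M : H →L[ℂ] F) (u : V) :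
    helmholtzOp (M ∘L V.subtypeL) u = V.orthogonalProjectionOnto (helmholtzOp M u) := by
  refine ext_inner_left ℂ fun v => ?_
  rw [inner_helmholtzOp, Submodule.inner_orthogonalProjectionOnto_eq_of_mem_left, inner_helmholtzOp]
  rfl

variable [Nontrivial V] (hMc : IsCompactOperator (M ∘L V.subtypeL))
  (hMi : Function.Injective (M ∘L V.subtypeL)) (hM : ‖M‖ ≤ 1)
  (h1 : (1 : ℝ) ∉ relativeEigenvalues (M ∘L V.subtypeL))

include hMc hMi hM h1

theorem exists_spectralGap_le_norm_inner_helmholtzOp_div {u : V} (hu : u ≠ 0) :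
    ∃ v : V, v ≠ 0 ∧ spectralGap (M ∘L V.subtypeL)
      ≤ ‖inner ℂ (v : H) (helmholtzOp M u)‖ / (‖u‖ * ‖v‖) := by
  have hL := norm_comp_subtypeL_le_one (V := V) hM
  set v : V := helmholtzOp (M ∘L V.subtypeL) u with hv
  have hle : spectralGap (M ∘L V.subtypeL) * ‖u‖ ≤ ‖v‖ := spectralGap_mul_norm_le hMc hMi hL h1 u
  have hv0 : 0 < ‖v‖ :=
    (mul_pos (spectralGap_pos hMc hMi hL h1) (norm_pos_iff.2 hu)).trans_le hle
  have hinner : ‖inner ℂ (v : H) (helmholtzOp M u)‖ = ‖v‖ * ‖v‖ := by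
    rw [← Submodule.inner_orthogonalProjectionOnto_eq_of_mem_left, ← helmholtzOp_comp_subtypeL,
      ← hv, ← inner_self_re_eq_norm, inner_self_eq_norm_mul_norm]
  refine ⟨v, norm_pos_iff.1 hv0, ?_⟩
  rwa [hinner, mul_div_mul_right _ _ hv0.ne', le_div_iff₀ (norm_pos_iff.2 hu)]

theorem exists_clm_forall_inner_helmholtzOp_eq_neg_iff :
    ∃ W : H →L[ℂ] V, (∀ (t : H) (w : V), (∀ v : V,
        inner ℂ (v : H) (helmholtzOp M w) = -inner ℂ (v : H) (helmholtzOp M t)) ↔ w = W t) ∧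
      ∀ t, spectralGap (M ∘L V.subtypeL) * ‖W t‖ ≤ ‖t‖ := by
  obtain ⟨S, hS⟩ := isUnit_helmholtzOp hMc h1
  let e : V ≃L[ℂ] V := .ofUnit S
  let W : H →L[ℂ] V :=
    e.symm.toContinuousLinearMap ∘L (-(V.orthogonalProjectionOnto ∘L helmholtzOp M))
  have hW (t : H) (w : V) :
      helmholtzOp (M ∘L V.subtypeL) w = -V.orthogonalProjectionOnto (helmholtzOp M t)
        ↔ w = W t := by
    change _ ↔ w = e.symm (-V.orthogonalProjectionOnto (helmholtzOp M t))
    rw [e.eq_symm_apply, ← hS]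
    rfl
  refine ⟨W, fun t w => ?_, fun t => ?_⟩
  · rw [← hW, ext_iff_inner_left ℂ]
    refine forall_congr' fun v => ?_
    rw [helmholtzOp_comp_subtypeL, inner_neg_right,
      Submodule.inner_orthogonalProjectionOnto_eq_of_mem_left,
      Submodule.inner_orthogonalProjectionOnto_eq_of_mem_left]
  · calc spectralGap (M ∘L V.subtypeL) * ‖W t‖
        ≤ ‖helmholtzOp (M ∘L V.subtypeL) (W t)‖ :=
          spectralGap_mul_norm_le hMc hMi (norm_comp_subtypeL_le_one hM) h1 _
      _ = ‖V.orthogonalProjectionOnto (helmholtzOp M t)‖ := by rw [(hW t _).2 rfl, norm_neg]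
      _ ≤ ‖helmholtzOp M t‖ := V.norm_orthogonalProjectionOnto_apply_le _
      _ ≤ ‖t‖ := norm_helmholtzOp_apply_le hM t

end GalerkinCorrection

theorem le_ciInf_ciSup_of_forall_exists {ι κ : Type*} [Nonempty ι] {f : ι → κ → ℝ} {β C : ℝ}
    (hf : ∀ i j, f i j ≤ C) (h : ∀ i, ∃ j, β ≤ f i j) : β ≤ ⨅ i, ⨆ j, f i j :=
  le_ciInf fun i =>
    let ⟨j, hj⟩ := h i
    le_ciSup_of_le ⟨C, Set.forall_mem_range.2 (hf i)⟩ j hj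

/-- A measurable weight that is essentially bounded between two positive constants. -/
structure IsBoundedWeight {α : Type*} [MeasurableSpace α] (g : α → ℝ) (μ : Measure α) : Prop where
  aemeasurable : AEMeasurable g μ
  exists_bound : ∃ C, ∀ᵐ x ∂μ, 0 < g x ∧ g x ≤ C ∧ (g x)⁻¹ ≤ C

namespace IsBoundedWeight

open scoped ENNReal

variable {α : Type*} [MeasurableSpace α] {μ : Measure α} {g : α → ℝ}

theorem of_bounds (hg : AEMeasurable g μ) {m M : ℝ} (hm : 0 < m)
    (h : ∀ᵐ x ∂μ, m ≤ g x ∧ g x ≤ M) : IsBoundedWeight g μ where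
  aemeasurable := hg
  exists_bound := ⟨max M m⁻¹, h.mono fun _ hx =>
    ⟨hm.trans_le hx.1, le_max_of_le_left hx.2, le_max_of_le_right (inv_anti₀ hm hx.1)⟩⟩

theorem inv (hg : IsBoundedWeight g μ) : IsBoundedWeight (fun x => (g x)⁻¹) μ where
  aemeasurable := hg.aemeasurable.inv
  exists_bound :=
    let ⟨C, hC⟩ := hg.exists_bound
    ⟨C, hC.mono fun x hx => ⟨inv_pos.2 hx.1, hx.2.2, (inv_inv (g x)).symm ▸ hx.2.1⟩⟩

theorem ae_pos (hg : IsBoundedWeight g μ) : ∀ᵐ x ∂μ, 0 < g x :=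
  let ⟨_, hC⟩ := hg.exists_bound
  hC.mono fun _ hx => hx.1

theorem const_mul (hg : IsBoundedWeight g μ) {k : ℝ} (hk : 0 < k) :
    IsBoundedWeight (fun x => k * g x) μ where
  aemeasurable := hg.aemeasurable.const_mul k
  exists_bound := by
    obtain ⟨C, hC⟩ := hg.exists_bound
    refine ⟨max (k * C) (k⁻¹ * C), hC.mono fun x hx => ⟨mul_pos hk hx.1, ?_, ?_⟩⟩
    · exact le_max_of_le_left (mul_le_mul_of_nonneg_left hx.2.1 hk.le)
    · rw [mul_inv]
      exact le_max_of_le_right (mul_le_mul_of_nonneg_left hx.2.2 (inv_pos.2 hk).le)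

theorem sqrt (hg : IsBoundedWeight g μ) : IsBoundedWeight (fun x => √(g x)) μ where
  aemeasurable := hg.aemeasurable.sqrt
  exists_bound :=
    let ⟨C, hC⟩ := hg.exists_bound
    ⟨√C, hC.mono fun x hx => ⟨Real.sqrt_pos.2 hx.1, Real.sqrt_le_sqrt hx.2.1,
      Real.sqrt_inv (g x) ▸ Real.sqrt_le_sqrt hx.2.2⟩⟩

variable {𝕜 : Type*} [RCLike 𝕜] {p : ℝ≥0∞} [Fact (1 ≤ p)]

theorem memLp_top (hg : IsBoundedWeight g μ) : MemLp (fun x => (g x : 𝕜)) ∞ μ := by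
  obtain ⟨C, hC⟩ := hg.exists_bound
  refine memLp_top_of_bound
    (RCLike.measurable_ofReal.comp_aemeasurable hg.aemeasurable).aestronglyMeasurable C ?_
  filter_upwards [hC] with x hx
  rw [RCLike.norm_ofReal, abs_of_pos hx.1]
  exact hx.2.1

variable (𝕜 p) in
/-- Multiplication by a bounded weight as an operator on `Lᵖ`. -/
def mulLp (hg : IsBoundedWeight g μ) : Lp 𝕜 p μ →L[𝕜] Lp 𝕜 p μ :=
  (ContinuousLinearMap.mul 𝕜 𝕜).holderL μ ∞ p p (hg.memLp_top.toLp _)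

theorem coeFn_mulLp (hg : IsBoundedWeight g μ) (f : Lp 𝕜 p μ) :
    hg.mulLp 𝕜 p f =ᵐ[μ] fun x => (g x : 𝕜) * f x := by
  filter_upwards [(ContinuousLinearMap.mul 𝕜 𝕜).coeFn_holder (r := p)
    ((hg.memLp_top (𝕜 := 𝕜)).toLp _) f, (hg.memLp_top (𝕜 := 𝕜)).coeFn_toLp] with x hx hgx
  rw [hgx] at hx
  exact hx

theorem mulLp_inv_mulLp (hg : IsBoundedWeight g μ) (f : Lp 𝕜 p μ) :
    hg.inv.mulLp 𝕜 p (hg.mulLp 𝕜 p f) = f := by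
  refine Lp.ext ?_
  filter_upwards [hg.inv.coeFn_mulLp (hg.mulLp 𝕜 p f), hg.coeFn_mulLp f, hg.ae_pos]
    with x hinv hmul hpos
  rw [hinv, hmul, RCLike.ofReal_inv, inv_mul_cancel_left₀ (RCLike.ofReal_ne_zero.2 hpos.ne')]

variable (𝕜 p) in
/-- Multiplication by a bounded weight as an automorphism of `Lᵖ`. -/
def mulLpEquiv (hg : IsBoundedWeight g μ) : Lp 𝕜 p μ ≃L[𝕜] Lp 𝕜 p μ :=
  .equivOfInverse (hg.mulLp 𝕜 p) (hg.inv.mulLp 𝕜 p) hg.mulLp_inv_mulLp fun f => by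
    simpa only [inv_inv] using hg.inv.mulLp_inv_mulLp f

theorem coeFn_mulLpEquiv (hg : IsBoundedWeight g μ) (f : Lp 𝕜 p μ) :
    hg.mulLpEquiv 𝕜 p f =ᵐ[μ] fun x => (g x : 𝕜) * f x := hg.coeFn_mulLp f

end IsBoundedWeight

namespace Helmholtz

open ContinuousLinearMap

variable {U : Opens Plane}

theorem continuous_setIntegral_mul {ψ : Plane → ℂ}
    (hψ : MemLp ψ 2 (volume.restrict (U : Set Plane))) :
    Continuous fun f : L2 U => ∫ x in (U : Set Plane), f x * ψ x := by
  have h (f : L2 U) : ∫ x in (U : Set Plane), f x * ψ x = inner ℂ (hψ.star.toLp _) f := by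
    rw [L2.inner_def]
    refine integral_congr_ae ?_
    filter_upwards [hψ.star.coeFn_toLp] with x hx
    rw [hx, RCLike.inner_apply, Pi.star_apply, RCLike.star_def, RCLike.conj_conj]
  simp_rw [h]
  fun_prop

theorem isClosed_sobolevH1 (U : Opens Plane) :
    IsClosed (sobolevH1 U : Set (L2 U × (Fin 2 → L2 U))) := by
  have h : (sobolevH1 U : Set (L2 U × (Fin 2 → L2 U))) = ⋂ (i : Fin 2) (φ : 𝓓(U, ℂ)),
      {w | ∫ x in (U : Set Plane), w.1 x * partialDeriv i φ x
        = -∫ x in (U : Set Plane), w.2 i x * φ x} := by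
    ext w
    simp [sobolevH1, IsWeakPartial]
  rw [h]
  refine isClosed_iInter fun i => isClosed_iInter fun φ => isClosed_eq ?_ ?_
  · exact (continuous_setIntegral_mul (memLp_partialDeriv φ i)).comp continuous_fst
  · exact ((continuous_setIntegral_mul (memLp_testFunction φ)).comp
      ((continuous_apply i).comp continuous_snd)).neg

/-- The Hilbert space of pairs of a function and a vector field in `L²(U)`. -/
abbrev GradHilbert (U : Opens Plane) : Type := WithLp 2 (L2 U × PiLp 2 fun _ : Fin 2 => L2 U)

variable {a κ : Plane → ℝ} (ha : IsBoundedWeight a (volume.restrict (U : Set Plane)))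
  (hκ : IsBoundedWeight κ (volume.restrict (U : Set Plane)))

/-- The map `(u, g) ↦ (κ u, √a g)`, which turns the energy norm into the norm of
`GradHilbert U`. -/
def weightEquiv : (L2 U × (Fin 2 → L2 U)) ≃L[ℂ] GradHilbert U :=
  ((hκ.mulLpEquiv ℂ 2).prodCongr
    ((ContinuousLinearEquiv.piCongrRight fun _ => ha.sqrt.mulLpEquiv ℂ 2).trans
      (PiLp.continuousLinearEquiv 2 ℂ fun _ : Fin 2 => L2 U).symm)).trans
    (WithLp.prodContinuousLinearEquiv 2 ℂ _ _).symm

/-- The space `H¹(U)` with the energy inner product, realized as `{(κ u, √a ∇u)}` in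
`GradHilbert U`. -/
def EnergySpace : Type := (sobolevH1 U).map (weightEquiv ha hκ).toLinearMap

instance : NormedAddCommGroup (EnergySpace ha hκ) :=
  inferInstanceAs (NormedAddCommGroup ((sobolevH1 U).map (weightEquiv ha hκ).toLinearMap))

instance : InnerProductSpace ℂ (EnergySpace ha hκ) :=
  inferInstanceAs (InnerProductSpace ℂ ((sobolevH1 U).map (weightEquiv ha hκ).toLinearMap))

instance : CompleteSpace (EnergySpace ha hκ) :=
  ((weightEquiv ha hκ).toHomeomorph.isClosedMap _ (isClosed_sobolevH1 U)).completeSpace_coe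

/-- The identification of `H¹(U)` with the energy space. -/
def energyEquiv : H1 U ≃L[ℂ] EnergySpace ha hκ := (weightEquiv ha hκ).submoduleMap (sobolevH1 U)

/-- The map `u ↦ κ u` on the energy space; its squared norm is the mass term. -/
def energyMass : EnergySpace ha hκ →L[ℂ] L2 U :=
  WithLp.fstL 2 ℂ _ _ ∘L ((sobolevH1 U).map (weightEquiv ha hκ).toLinearMap).subtypeL

theorem norm_energyMass_le_one : ‖energyMass ha hκ‖ ≤ 1 := by
  refine opNorm_le_bound _ zero_le_one fun u => ?_
  rw [one_mul]
  exact WithLp.norm_fst_le _ _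

theorem energyMass_energyEquiv (u : H1 U) :
    energyMass ha hκ (energyEquiv ha hκ u) = hκ.mulLpEquiv ℂ 2 u.fn := rfl

theorem massForm_eq_inner (u v : H1 U) :
    massForm U κ u v = inner ℂ (energyMass ha hκ (energyEquiv ha hκ v))
      (energyMass ha hκ (energyEquiv ha hκ u)) := by
  rw [energyMass_energyEquiv, energyMass_energyEquiv, L2.inner_def]
  refine integral_congr_ae ?_
  filter_upwards [hκ.coeFn_mulLpEquiv u.fn, hκ.coeFn_mulLpEquiv v.fn] with x hu hv
  rw [hu, hv, RCLike.inner_apply, map_mul, RCLike.conj_ofReal, RCLike.ofReal_eq_complex_ofReal]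
  ring

theorem diffForm_eq_sum_inner (ha : IsBoundedWeight a (volume.restrict (U : Set Plane)))
    (u v : H1 U) :
    diffForm U a u v = ∑ i, inner ℂ (ha.sqrt.mulLpEquiv ℂ 2 (v.grad i))
      (ha.sqrt.mulLpEquiv ℂ 2 (u.grad i)) := by
  simp_rw [L2.inner_def]
  rw [← integral_finsetSum _ fun i _ => L2.integrable_inner _ _]
  refine integral_congr_ae ?_
  have hsqrt (w : H1 U) := ae_all_iff.2 fun i => ha.sqrt.coeFn_mulLpEquiv (p := 2) (w.grad i)
  filter_upwards [hsqrt u, hsqrt v, ha.ae_pos] with x hu hv hx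
  have hmul : (√(a x) : ℂ) * √(a x) = a x := by exact_mod_cast Real.mul_self_sqrt hx.le
  rw [Finset.mul_sum]
  refine Finset.sum_congr rfl fun i _ => ?_
  rw [hu, hv, RCLike.inner_apply, map_mul, RCLike.conj_ofReal, RCLike.ofReal_eq_complex_ofReal,
    ← hmul]
  ring

theorem diffForm_add_massForm_eq_inner (u v : H1 U) :
    diffForm U a u v + massForm U κ u v
      = inner ℂ (energyEquiv ha hκ v) (energyEquiv ha hκ u) := by
  change _ = inner ℂ (weightEquiv ha hκ v.1) (weightEquiv ha hκ u.1)
  rw [WithLp.prod_inner_apply, PiLp.inner_apply, diffForm_eq_sum_inner ha,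
    massForm_eq_inner ha hκ, add_comm]
  rfl

theorem helmholtzForm_eq_inner (u v : H1 U) :
    helmholtzForm U a κ u v
      = inner ℂ (energyEquiv ha hκ v) (helmholtzOp (energyMass ha hκ) (energyEquiv ha hκ u)) := by
  rw [inner_helmholtzOp, ← diffForm_add_massForm_eq_inner, ← massForm_eq_inner, helmholtzForm]
  ring

theorem energyNorm_eq_norm (u : H1 U) : energyNorm U a κ u = ‖energyEquiv ha hκ u‖ := by
  rw [energyNorm, diffForm_add_massForm_eq_inner ha hκ, norm_eq_sqrt_re_inner (𝕜 := ℂ)]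
  rfl

/-- The image of `H¹₀(U)` in the energy space. -/
abbrev energyH10 : Submodule ℂ (EnergySpace ha hκ) :=
  (H10 U).map (energyEquiv ha hκ).toLinearMap

instance : CompleteSpace (energyH10 ha hκ) :=
  ((energyEquiv ha hκ).toHomeomorph.isClosedMap _
    (Submodule.isClosed_topologicalClosure _)).completeSpace_coe

/-- The identification of `H¹₀(U)` with its image in the energy space. -/
def energyH10Equiv : H10 U ≃L[ℂ] energyH10 ha hκ := (energyEquiv ha hκ).submoduleMap (H10 U)

/-- The map `u ↦ κ u` on the image of `H¹₀(U)` in the energy space. -/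
abbrev energyMassH10 : energyH10 ha hκ →L[ℂ] L2 U :=
  energyMass ha hκ ∘L (energyH10 ha hκ).subtypeL

theorem nontrivial_energyH10 (hU : (U : Set Plane).Nonempty) : Nontrivial (energyH10 ha hκ) :=
  have := nontrivial_H10 hU
  (energyH10Equiv ha hκ).injective.nontrivial

theorem energyMassH10_eq_comp :
    energyMassH10 ha hκ = (hκ.mulLpEquiv ℂ 2).toContinuousLinearMap ∘L H10.fnL U ∘L
      (energyH10Equiv ha hκ).symm.toContinuousLinearMap := by
  ext1 w
  obtain ⟨u, rfl⟩ := (energyH10Equiv ha hκ).surjective w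
  change _ = hκ.mulLpEquiv ℂ 2 (H10.fnL U ((energyH10Equiv ha hκ).symm (energyH10Equiv ha hκ u)))
  rw [ContinuousLinearEquiv.symm_apply_apply]
  rfl

theorem energyMassH10_injective : Function.Injective (energyMassH10 ha hκ) := by
  rw [energyMassH10_eq_comp]
  exact (hκ.mulLpEquiv ℂ 2).injective.comp
    ((H1.fn_injective.comp Subtype.val_injective).comp (energyH10Equiv ha hκ).symm.injective)

theorem isCompactOperator_energyMassH10 (hU : Bornology.IsBounded (U : Set Plane)) :
    IsCompactOperator (energyMassH10 ha hκ) := by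
  rw [energyMassH10_eq_comp]
  have h : IsCompactOperator (H10.fnL U ∘L (energyH10Equiv ha hκ).symm.toContinuousLinearMap) :=
    IsCompactOperator.comp_clm (H10.isCompactOperator_fnL hU) _
  exact IsCompactOperator.clm_comp h (hκ.mulLpEquiv ℂ 2).toContinuousLinearMap

theorem dirichletEigenvalues_eq_relativeEigenvalues :
    dirichletEigenvalues U a κ = relativeEigenvalues (energyMassH10 ha hκ) := by
  ext μ
  let e := energyEquiv ha hκ
  have hiff (b v : H1 U) : diffForm U a b v = μ * massForm U κ b v ↔
      inner ℂ (e v) (e b) - inner ℂ (energyMass ha hκ (e v)) (energyMass ha hκ (e b))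
        = μ * inner ℂ (energyMass ha hκ (e v)) (energyMass ha hκ (e b)) := by
    rw [← diffForm_add_massForm_eq_inner, ← massForm_eq_inner, add_sub_cancel_right]
  constructor
  · rintro ⟨b, hb, hb0, h⟩
    refine ⟨⟨e b, Submodule.mem_map_of_mem hb⟩, fun h0 => hb0 ?_, ?_⟩
    · exact e.map_eq_zero_iff.1 (congrArg Subtype.val h0)
    · rintro ⟨_, v, hv, rfl⟩
      exact (hiff b v).1 (h v hv)
  · rintro ⟨⟨_, b, hb, rfl⟩, hb0, h⟩
    refine ⟨b, hb, fun h0 => hb0 ?_, fun v hv => (hiff b v).2 ?_⟩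
    · exact Subtype.ext (e.map_eq_zero_iff.2 h0)
    · exact h ⟨e v, Submodule.mem_map_of_mem hv⟩

theorem infSupConst_eq_spectralGap :
    infSupConst U a κ = spectralGap (energyMassH10 ha hκ) := by
  rw [infSupConst, spectralGap, dirichletEigenvalues_eq_relativeEigenvalues ha hκ]

include ha hκ

theorem norm_helmholtzForm_comm (u v : H1 U) :
    ‖helmholtzForm U a κ u v‖ = ‖helmholtzForm U a κ v u‖ := by
  rw [helmholtzForm_eq_inner ha hκ, helmholtzForm_eq_inner ha hκ, norm_inner_symm]
  exact congrArg norm ((isSelfAdjoint_helmholtzOp (energyMass ha hκ)).isSymmetric _ _)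

theorem norm_helmholtzForm_le (u v : H1 U) :
    ‖helmholtzForm U a κ u v‖ ≤ energyNorm U a κ u * energyNorm U a κ v := by
  rw [helmholtzForm_eq_inner ha hκ, energyNorm_eq_norm ha hκ, energyNorm_eq_norm ha hκ, mul_comm]
  exact (norm_inner_le_norm _ _).trans (mul_le_mul_of_nonneg_left
    (norm_helmholtzOp_apply_le (norm_energyMass_le_one ha hκ) _) (norm_nonneg _))

theorem norm_helmholtzForm_div_le_one (u v : H1 U) :
    ‖helmholtzForm U a κ u v‖ / (energyNorm U a κ u * energyNorm U a κ v) ≤ 1 :=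
  div_le_one_of_le₀ (norm_helmholtzForm_le ha hκ u v)
    (mul_nonneg (Real.sqrt_nonneg _) (Real.sqrt_nonneg _))

theorem energyNorm_add_le (u v : H1 U) :
    energyNorm U a κ (u + v) ≤ energyNorm U a κ u + energyNorm U a κ v := by
  simp only [energyNorm_eq_norm ha hκ, map_add]
  exact norm_add_le _ _

theorem isCorrection_neg {t : H1 U} (ht : t ∈ H10 U) : IsCorrection U a κ t (-t) := by
  refine ⟨neg_mem ht, fun v _ => ?_⟩
  rw [helmholtzForm_eq_inner ha hκ, helmholtzForm_eq_inner ha hκ, map_neg, map_neg, inner_neg_right]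

variable (hU_ne : (U : Set Plane).Nonempty) (hU_bdd : Bornology.IsBounded (U : Set Plane))
  (h1 : (1 : ℝ) ∉ dirichletEigenvalues U a κ)

include hU_ne hU_bdd h1

theorem infSupConst_pos : 0 < infSupConst U a κ := by
  have := nontrivial_energyH10 ha hκ hU_ne
  rw [dirichletEigenvalues_eq_relativeEigenvalues ha hκ] at h1
  rw [infSupConst_eq_spectralGap ha hκ]
  exact spectralGap_pos (isCompactOperator_energyMassH10 ha hκ hU_bdd)
    (energyMassH10_injective ha hκ) (norm_comp_subtypeL_le_one (norm_energyMass_le_one ha hκ)) h1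

theorem exists_infSupConst_le_norm_helmholtzForm_div {u : H10 U} (hu : u ≠ 0) :
    ∃ v : H10 U, v ≠ 0 ∧ infSupConst U a κ
      ≤ ‖helmholtzForm U a κ u v‖ / (energyNorm U a κ u * energyNorm U a κ v) := by
  have := nontrivial_energyH10 ha hκ hU_ne
  rw [dirichletEigenvalues_eq_relativeEigenvalues ha hκ] at h1
  obtain ⟨v, hv, h⟩ := exists_spectralGap_le_norm_inner_helmholtzOp_div
    (isCompactOperator_energyMassH10 ha hκ hU_bdd) (energyMassH10_injective ha hκ)
    (norm_energyMass_le_one ha hκ) h1 ((energyH10Equiv ha hκ).map_ne_zero_iff.2 hu)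
  obtain ⟨v, rfl⟩ := (energyH10Equiv ha hκ).surjective v
  refine ⟨v, (energyH10Equiv ha hκ).map_ne_zero_iff.1 hv, ?_⟩
  rwa [infSupConst_eq_spectralGap ha hκ, helmholtzForm_eq_inner ha hκ, energyNorm_eq_norm ha hκ,
    energyNorm_eq_norm ha hκ]

theorem infSupConst_le_iInf_iSup :
    infSupConst U a κ ≤ ⨅ u : {u : H10 U // u ≠ 0}, ⨆ v : {v : H10 U // v ≠ 0},
      ‖helmholtzForm U a κ u.1 v.1‖ / (energyNorm U a κ u.1 * energyNorm U a κ v.1) := by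
  have := nontrivial_H10 hU_ne
  have : Nonempty {u : H10 U // u ≠ 0} := nonempty_subtype.2 (exists_ne 0)
  refine le_ciInf_ciSup_of_forall_exists
    (fun u v => norm_helmholtzForm_div_le_one ha hκ u.1 v.1) fun u => ?_
  obtain ⟨v, hv, h⟩ :=
    exists_infSupConst_le_norm_helmholtzForm_div ha hκ hU_ne hU_bdd h1 u.2
  exact ⟨⟨v, hv⟩, h⟩

theorem infSupConst_le_iInf_iSup_swap :
    infSupConst U a κ ≤ ⨅ v : {v : H10 U // v ≠ 0}, ⨆ u : {u : H10 U // u ≠ 0},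
      ‖helmholtzForm U a κ u.1 v.1‖ / (energyNorm U a κ u.1 * energyNorm U a κ v.1) := by
  simpa only [norm_helmholtzForm_comm ha hκ, mul_comm] using
    infSupConst_le_iInf_iSup ha hκ hU_ne hU_bdd h1

theorem exists_clm_forall_isCorrection_iff :
    ∃ W : H1 U →L[ℂ] H1 U, (∀ t w, IsCorrection U a κ t w ↔ w = W t) ∧
      ∀ t, infSupConst U a κ * energyNorm U a κ (W t) ≤ energyNorm U a κ t := by
  have := nontrivial_energyH10 ha hκ hU_ne
  rw [dirichletEigenvalues_eq_relativeEigenvalues ha hκ] at h1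
  obtain ⟨W, hW, hWn⟩ := exists_clm_forall_inner_helmholtzOp_eq_neg_iff
    (isCompactOperator_energyMassH10 ha hκ hU_bdd) (energyMassH10_injective ha hκ)
    (norm_energyMass_le_one ha hκ) h1
  let e := energyEquiv ha hκ
  let e₀ := energyH10Equiv ha hκ
  have hiff (t : H1 U) (w : H10 U) : IsCorrection U a κ t w ↔ e₀ w = W (e t) := by
    simp only [← hW, IsCorrection, SetLike.coe_mem, true_and, helmholtzForm_eq_inner ha hκ]
    refine ⟨fun h => ?_, fun h v hv => h ⟨e v, Submodule.mem_map_of_mem hv⟩⟩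
    rintro ⟨_, v, hv, rfl⟩
    exact h v hv
  refine ⟨(H10 U).subtypeL ∘L e₀.symm.toContinuousLinearMap ∘L W ∘L e.toContinuousLinearMap,
    fun t w => ⟨fun h => ?_, ?_⟩, fun t => ?_⟩
  · exact congrArg Subtype.val (e₀.eq_symm_apply.2 ((hiff t ⟨w, h.1⟩).1 h))
  · rintro rfl
    exact (hiff t _).2 (e₀.apply_symm_apply _)
  · rw [infSupConst_eq_spectralGap ha hκ, energyNorm_eq_norm ha hκ, energyNorm_eq_norm ha hκ]
    change _ * ‖e₀ (e₀.symm (W (e t)))‖ ≤ _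
    rw [e₀.apply_symm_apply]
    exact hWn (e t)

theorem existsUnique_isCorrection (t : H1 U) : ∃! w, IsCorrection U a κ t w := by
  obtain ⟨W, hW, -⟩ := exists_clm_forall_isCorrection_iff ha hκ hU_ne hU_bdd h1
  simp only [hW, existsUnique_eq]

theorem exists_helmholtzExtension :
    ∃ E : TraceSpace U →L[ℂ] H1 U, IsHelmholtzExtension U a κ E ∧
      (∀ E' : TraceSpace U → H1 U, IsHelmholtzExtension U a κ E' → E' = E) ∧
      ∀ (τ : TraceSpace U) (t : H1 U), trace t = τ →
        energyNorm U a κ (E τ) ≤ (1 + 1 / infSupConst U a κ) * energyNorm U a κ t := by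
  obtain ⟨W, hW, hWn⟩ := exists_clm_forall_isCorrection_iff ha hκ hU_ne hU_bdd h1
  have hβ := infSupConst_pos ha hκ hU_ne hU_bdd h1
  have hker : H10 U ≤ (ContinuousLinearMap.id ℂ (H1 U) + W).ker := fun t ht => by
    change t + W t = 0
    rw [← (hW t _).1 (isCorrection_neg ha hκ ht), add_neg_cancel]
  refine ⟨(H10 U).liftQL _ hker, ?_, fun E' hE' => ?_, ?_⟩
  · rintro _ t rfl
    exact ⟨W t, (hW t _).2 rfl, rfl⟩
  · funext τ
    obtain ⟨t, rfl⟩ := (H10 U).mkQ_surjective τ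
    obtain ⟨w, hw, hE⟩ := hE' _ t rfl
    exact hE.trans (congrArg (t + ·) ((hW t w).1 hw))
  · rintro _ t rfl
    calc energyNorm U a κ (t + W t)
        ≤ energyNorm U a κ t + energyNorm U a κ (W t) := energyNorm_add_le ha hκ _ _
      _ ≤ energyNorm U a κ t + (infSupConst U a κ)⁻¹ * energyNorm U a κ t :=
          add_le_add_right ((le_inv_mul_iff₀ hβ).2 (hWn t)) _
      _ = (1 + 1 / infSupConst U a κ) * energyNorm U a κ t := by ring

end Helmholtz

end

theorem mainTheorem8
    (U : Opens Helmholtz.Plane) (hU_ne : (U : Set Helmholtz.Plane).Nonempty)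
    (hU_bdd : Bornology.IsBounded (U : Set Helmholtz.Plane))
    (a c : Helmholtz.Plane → ℝ) (ω amin amax cmin cmax : ℝ)
    (hω : 0 < ω) (hamin : 0 < amin) (hcmin : 0 < cmin)
    (ha_meas : AEMeasurable a (volume.restrict (U : Set Helmholtz.Plane)))
    (hc_meas : AEMeasurable c (volume.restrict (U : Set Helmholtz.Plane)))
    (ha : ∀ᵐ x ∂(volume.restrict (U : Set Helmholtz.Plane)), amin ≤ a x ∧ a x ≤ amax)
    (hc : ∀ᵐ x ∂(volume.restrict (U : Set Helmholtz.Plane)), cmin ≤ c x ∧ c x ≤ cmax)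
    (κ : Helmholtz.Plane → ℝ) (hκ : κ = fun x => ω / c x)
    (h_eig : ∀ μ ∈ Helmholtz.dirichletEigenvalues U a κ, μ ≠ 1) :
    -- the constant is positive
    0 < Helmholtz.infSupConst U a κ ∧
    -- the inf-sup condition, with the infimum over the first argument
    (Helmholtz.infSupConst U a κ ≤
      ⨅ u : {u : Helmholtz.H10 U // u ≠ 0}, ⨆ v : {v : Helmholtz.H10 U // v ≠ 0},
        ‖Helmholtz.helmholtzForm U a κ u.1 v.1‖ /
          (Helmholtz.energyNorm U a κ u.1 * Helmholtz.energyNorm U a κ v.1)) ∧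
    -- the inf-sup condition, with the infimum over the second argument
    (Helmholtz.infSupConst U a κ ≤
      ⨅ v : {v : Helmholtz.H10 U // v ≠ 0}, ⨆ u : {u : Helmholtz.H10 U // u ≠ 0},
        ‖Helmholtz.helmholtzForm U a κ u.1 v.1‖ /
          (Helmholtz.energyNorm U a κ u.1 * Helmholtz.energyNorm U a κ v.1)) ∧
    -- unique solvability of the local problems that define the extension
    (∀ t : Helmholtz.H1 U, ∃! t₀ : Helmholtz.H1 U, Helmholtz.IsCorrection U a κ t t₀) ∧
    -- the extension operator exists, is unique, linear and continuous, and obeys the bound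
    (∃ E : Helmholtz.TraceSpace U →L[ℂ] Helmholtz.H1 U,
      Helmholtz.IsHelmholtzExtension U a κ E ∧
      (∀ E' : Helmholtz.TraceSpace U → Helmholtz.H1 U,
        Helmholtz.IsHelmholtzExtension U a κ E' → E' = E) ∧
      ∀ (τ : Helmholtz.TraceSpace U) (t : Helmholtz.H1 U), Helmholtz.trace t = τ →
        Helmholtz.energyNorm U a κ (E τ) ≤
          (1 + 1 / Helmholtz.infSupConst U a κ) * Helmholtz.energyNorm U a κ t) := by
  have ha' := IsBoundedWeight.of_bounds ha_meas hamin ha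
  have hκ' : IsBoundedWeight κ (volume.restrict (U : Set Helmholtz.Plane)) := by
    simpa only [hκ, div_eq_mul_inv] using
      (IsBoundedWeight.of_bounds hc_meas hcmin hc).inv.const_mul hω
  have h1 : (1 : ℝ) ∉ Helmholtz.dirichletEigenvalues U a κ := fun h => h_eig 1 h rfl
  exact ⟨Helmholtz.infSupConst_pos ha' hκ' hU_ne hU_bdd h1,
    Helmholtz.infSupConst_le_iInf_iSup ha' hκ' hU_ne hU_bdd h1,
    Helmholtz.infSupConst_le_iInf_iSup_swap ha' hκ' hU_ne hU_bdd h1,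
    Helmholtz.existsUnique_isCorrection ha' hκ' hU_ne hU_bdd h1,
    Helmholtz.exists_helmholtzExtension ha' hκ' hU_ne hU_bdd h1⟩
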